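/- Theorem 4.1 (Wohlfahrt's Theorem for $G_5$). Let $\lambda = 2\cos(\pi/5)$, let $T=\begin{pmatrix}1&\lambda\\0&1\end{pmatrix}$ and $S=\begin{pmatrix}0&1\\-1&0\end{pmatrix}$, let $H_5=\langle S,T\rangle\subseteq SL(2,\mathbb Z[\lambda])$ and $Z=\{\pm I\}\subseteq H_5$, and let $G_5=H_5/Z$. For $\tau\in\mathbb Z[\lambda]$ put $H(\tau)=\{A\in H_5 : A\equiv I \pmod{\tau}\}$ and $G(\tau)=H(\tau)Z/Z$. A subgroup $K\subseteq G_5$ is a congruence subgroup if $G(\tau)\subseteq K$ for some $\tau\neq 0$. Its algebraic level is the ideal $(\pi)$, $0\ne\pi\in\mathbb Z[\lambda]$, for which $G(\pi)$ is the largest principal congruence subgroup contained in $K$: $G(\pi)\subseteq K$, and $G(\tau)\subseteq G(\pi)$ whenever $G(\tau)\subseteq K$. The cusps of $K$ are the points of $\mathbb R\cup\{\infty\}$ fixed by a parabolic element of $K$; the width of a cusp $x$ is the smallest positive integer $m$ such that $\pm T^m$ is conjugate in $G_5$ to an element of $K$ fixing $x$; the geometric level of $K$ is the least common multiple of its cusp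 widths. Let $K\subseteq G_5$ be a congruence subgroup of geometric level $r$ and algebraic level $(\pi)$, and let $n$ be the smallest positive rational integer in $(\pi)$. (i) If $r$ is odd, then $G(r)\subseteq K$ and $n=r$. (ii) If $r\equiv 2\pmod 4$, then $G(r)\subseteq K$ and $n=r$. (iii) If $4\mid r$, then $G(2r)\subseteq K$ and $n$ is either $r$ or $2r$. -/

import Mathlib

open scoped MatrixGroups

noncomputable section

namespace Hecke

/-- The number `λ = 2 cos (π / 5)`. -/
def lam : ℝ := 2 * Real.cos (Real.pi / 5)

/-- The ring `ℤ[λ]`. -/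
abbrev ZLam : Subalgebra ℤ ℝ := Algebra.adjoin ℤ {lam}

/-- `λ` as an element of `ℤ[λ]`. -/
def lamZ : ZLam := ⟨lam, Algebra.self_mem_adjoin_singleton ℤ lam⟩

/-- The matrix `T = (1 λ; 0 1)`. -/
def matT : SL(2, ZLam) := ⟨!![1, lamZ; 0, 1], by simp [Matrix.det_fin_two_of]⟩

/-- The matrix `S = (0 1; -1 0)`. -/
def matS : SL(2, ZLam) := ⟨!![0, 1; -1, 0], by simp [Matrix.det_fin_two_of]⟩

/-- The homogeneous Hecke group `H₅ = ⟨S, T⟩`. -/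
def H5 : Subgroup SL(2, ZLam) := Subgroup.closure {matS, matT}

/-- `S` as an element of `H₅`. -/
def S : H5 := ⟨matS, Subgroup.subset_closure (by simp)⟩

/-- `T` as an element of `H₅`. -/
def T : H5 := ⟨matT, Subgroup.subset_closure (by simp)⟩

/-- The matrix `-I` belongs to `H₅`: it is `S²`. -/
theorem neg_one_mem_H5 : (-1 : SL(2, ZLam)) ∈ H5 := by
  have h : matS * matS = -1 := by
    apply Subtype.ext
    rw [Matrix.SpecialLinearGroup.coe_mul, Matrix.SpecialLinearGroup.coe_neg,
      Matrix.SpecialLinearGroup.coe_one]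
    ext i j
    fin_cases i <;> fin_cases j <;> simp [matS, Matrix.mul_apply]
  exact h ▸ H5.mul_mem S.2 S.2

/-- The central subgroup `Z = ⟨±I⟩` of `H₅`. -/
def Z : Subgroup H5 := Subgroup.zpowers ⟨-1, neg_one_mem_H5⟩

theorem Z_le_center : Z ≤ Subgroup.center H5 := by
  rw [Z, Subgroup.zpowers_le, Subgroup.mem_center_iff]
  intro g
  apply Subtype.ext
  simp

instance Z_normal : Z.Normal :=
  ⟨fun n hn g => by
    have h := Subgroup.mem_center_iff.mp (Z_le_center hn) g
    rw [h, mul_inv_cancel_right]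
    exact hn⟩

/-- The inhomogeneous Hecke group `G₅ = H₅ / Z`, in which a matrix and its negative are
identified. -/
abbrev G5 : Type := H5 ⧸ Z

/-- The principal congruence subgroup `H(π)` of `H₅`: the matrices in `H₅` that are congruent
to `I` modulo `π`. -/
def principalH (ϖ : ZLam) : Subgroup H5 :=
  (Matrix.SpecialLinearGroup.map (n := Fin 2)
    (Ideal.Quotient.mk (Ideal.span {ϖ}))).ker.subgroupOf H5

/-- The principal congruence subgroup `G(π) = H(π) Z / Z` of `G₅`. -/
def principalG (ϖ : ZLam) : Subgroup G5 := (principalH ϖ).map (QuotientGroup.mk' Z)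

/-- `K` is a congruence subgroup of `G₅`: it contains `G(π)` for some nonzero `π`. -/
def IsCongruence (K : Subgroup G5) : Prop := ∃ ϖ : ZLam, ϖ ≠ 0 ∧ principalG ϖ ≤ K

/-- `(π)` is the algebraic level of `K`: `G(π)` is the largest principal congruence subgroup
contained in `K`. -/
def IsAlgebraicLevel (K : Subgroup G5) (ϖ : ZLam) : Prop :=
  ϖ ≠ 0 ∧ principalG ϖ ≤ K ∧ ∀ τ : ZLam, principalG τ ≤ K → principalG τ ≤ principalG ϖ

/-- The rational integer below `(π)`: the smallest positive rational integer in `(π)`. -/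
def integerBelow (ϖ : ZLam) : ℕ := sInf {m : ℕ | 0 < m ∧ (m : ZLam) ∈ Ideal.span {ϖ}}

/-- The inclusion of `H₅` in `GL(2, ℝ)`. The latter acts on `ℝ ∪ {∞}` by Möbius
transformations. -/
def toGL : H5 →* GL (Fin 2) ℝ := (Matrix.SpecialLinearGroup.mapGL ℝ).comp H5.subtype

/-- `x ∈ ℝ ∪ {∞}` is a cusp of `K`: it is fixed by a parabolic element of `K`, that is, by a
parabolic matrix `A ∈ H₅` whose class `±A` lies in `K`. -/
def IsCuspOf (K : Subgroup G5) (x : OnePoint ℝ) : Prop :=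
  IsCusp x ((K.comap (QuotientGroup.mk' Z)).map toGL)

/-- The width of the cusp `x` of `K`: the smallest positive integer `m` such that `±T ^ m` is
conjugate in `G₅` to an element `±A` of `K` which fixes `x`. -/
def cuspWidth (K : Subgroup G5) (x : OnePoint ℝ) : ℕ :=
  sInf {m : ℕ | 0 < m ∧ ∃ A : H5, (A : G5) ∈ K ∧ IsConj ((T : G5) ^ m) (A : G5) ∧
    toGL A • x = x}

/-- The geometric level of `K`: the least common multiple of its cusp widths. -/
def geometricLevel (K : Subgroup G5) : ℕ :=
  sInf {N : ℕ | 0 < N ∧ ∀ x : OnePoint ℝ, IsCuspOf K x → cuspWidth K x ∣ N}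

end Hecke

end

noncomputable section

namespace Hecke

/-! ### The ring `ℤ[λ]` -/

/-! Write N(m) for the normal closure of T^m in H₅ (`normalT`). Every point g∞ is a cusp of K whose
width divides r, so the preimage of K in H₅ contains N(r); it also contains H(n) for some positive
integer n. Hence it suffices to show H(m) ≤ N(r)H(n) for every n ≠ 0, with m = r or m = 2r
(`principalH_le_of_forall` type statements, collected in `principalG_le_of_forall`).

At primes dividing r the inclusion comes from linearization. Modulo M², the elements I + MA of N(M)
multiply by adding the A's, and the resulting additive group is stable under conjugation by H₅. It
contains twice every trace-zero matrix (`two_smul_mem_linearPart`). So H(M) ≤ N(M)H(sM) for odd s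
dividing M, and H(2M) ≤ N(M)H(M²) in general; the lost factor 2 is the source of 2r when 4 ∣ r. At
primes not dividing r, Bézout and N(1) = H₅ give N(c)H(b) = H₅ for coprime c and b. For r ≡ 2 mod 4
the prime 2 is handled by H(2) ≤ N(2), read off from a dihedral quotient. The Chinese remainder
theorem glues the two parts.

For the integer n below (π): G(n) ≤ G(π) ≤ K forces all cusp widths to divide n, so r ≤ n.
Conversely G(m) ≤ K implies G(m) ≤ G(π), so T^m gives π ∣ mλ; as λ is a unit, n ∣ m.

Widths are tractable because every cusp is some g∞ and the stabilizer of ∞ commutes with T. Both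
facts follow from writing elements as words in the nonnegative matrices U^i S, 1 ≤ i ≤ 4. -/

theorem lam_sq : lam ^ 2 = lam + 1 := by
  have h5 : √(5 : ℝ) ^ 2 = 5 := Real.sq_sqrt (by norm_num)
  rw [lam, Real.cos_pi_div_five]
  linear_combination h5 / 4

theorem one_lt_lam : 1 < lam := by
  have h5 : (1 : ℝ) < √5 := by rw [Real.lt_sqrt] <;> norm_num
  rw [lam, Real.cos_pi_div_five]
  linarith

theorem lamZ_sq : lamZ ^ 2 = lamZ + 1 := Subtype.ext lam_sq

theorem exists_int_coords (x : ZLam) : ∃ a b : ℤ, x = a + b * lamZ := by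
  obtain ⟨x, hx⟩ := x
  induction hx using Algebra.adjoin_induction with
  | mem y hy =>
    obtain rfl : y = lam := hy
    exact ⟨0, 1, Subtype.ext (by simp [lamZ])⟩
  | algebraMap n => exact ⟨n, 0, Subtype.ext (by simp)⟩
  | add y z _ _ hy hz =>
    obtain ⟨a, b, h⟩ := hy
    obtain ⟨c, d, h'⟩ := hz
    refine ⟨a + c, b + d, ?_⟩
    have := congrArg₂ (· + ·) h h'
    push_cast
    refine Eq.trans this ?_
    ring
  | mul y z _ _ hy hz =>
    obtain ⟨a, b, h⟩ := hy
    obtain ⟨c, d, h'⟩ := hz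
    refine ⟨a * c + b * d, a * d + b * c + b * d, ?_⟩
    have := congrArg₂ (· * ·) h h'
    push_cast
    refine Eq.trans this ?_
    linear_combination (b * d : ZLam) * lamZ_sq

theorem lam_eq_goldenRatio : lam = Real.goldenRatio := by
  rw [lam, Real.cos_pi_div_five, Real.goldenRatio]
  ring

theorem eq_zero_of_coords {a b : ℤ} (h : (a + b * lamZ : ZLam) = 0) : a = 0 ∧ b = 0 := by
  have h' : (a : ℝ) + b * lam = 0 := by simpa [lamZ] using congrArg Subtype.val h
  have hb : b = 0 := by
    by_contra hb
    refine (Real.goldenRatio_irrational.intCast_mul hb).ne_int (-a) ?_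
    rw [← lam_eq_goldenRatio]
    push_cast
    linarith
  subst hb
  simpa using h'

/-- A nonzero element of `ℤ[λ]` divides a positive rational integer. -/
theorem exists_pos_nat_dvd {x : ZLam} (hx : x ≠ 0) : ∃ n : ℕ, 0 < n ∧ x ∣ (n : ZLam) := by
  obtain ⟨a, b, rfl⟩ := exists_int_coords x
  -- The second factor is the Galois conjugate, since λ is sent to 1 - λ; the product is the norm.
  have hnorm : (a + b * lamZ : ZLam) * ((a + b : ℤ) + (-b : ℤ) * lamZ) =
      ((a * (a + b) - b * b : ℤ) : ZLam) := by
    push_cast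
    linear_combination -(b * b : ZLam) * lamZ_sq
  have hne : a * (a + b) - b * b ≠ 0 := by
    intro h0
    rw [h0, Int.cast_zero] at hnorm
    obtain ⟨h1, h2⟩ := eq_zero_of_coords ((mul_eq_zero.mp hnorm).resolve_left hx)
    obtain rfl : b = 0 := by omega
    obtain rfl : a = 0 := by omega
    simp at hx
  refine ⟨(a * (a + b) - b * b).natAbs, Int.natAbs_pos.mpr hne, ?_⟩
  rw [← Int.cast_natCast, Int.natCast_natAbs]
  rcases abs_choice (a * (a + b) - b * b) with h | h <;> rw [h]
  · exact ⟨_, hnorm.symm⟩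
  · rw [Int.cast_neg, dvd_neg]
    exact ⟨_, hnorm.symm⟩

/-! ### Matrices and principal congruence subgroups -/

/-- The underlying matrix of an element of `H₅`. -/
def mat : H5 →* Matrix (Fin 2) (Fin 2) ZLam where
  toFun A := A.1.1
  map_one' := rfl
  map_mul' _ _ := rfl

theorem mat_injective : Function.Injective mat :=
  fun _ _ h => Subtype.ext (Subtype.ext h)

theorem mat_det (A : H5) : (mat A).det = 1 := A.1.2

theorem mat_det_entries (A : H5) : mat A 0 0 * mat A 1 1 - mat A 0 1 * mat A 1 0 = 1 := by
  rw [← Matrix.det_fin_two, mat_det]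

theorem mat_inv (A : H5) : mat A⁻¹ = (mat A).adjugate := rfl

theorem mat_T : mat T = !![1, lamZ; 0, 1] := rfl

theorem mat_S : mat S = !![0, 1; -1, 0] := rfl

theorem mat_T_pow (n : ℕ) : mat (T ^ n) = !![1, n * lamZ; 0, 1] := by
  induction n with
  | zero => ext i j; fin_cases i <;> fin_cases j <;> simp
  | succ n ih =>
    rw [pow_succ, map_mul, ih, mat_T]
    ext i j
    fin_cases i <;> fin_cases j <;> simp [Matrix.mul_apply]
    ring

theorem mem_principalH {ϖ : ZLam} {A : H5} : A ∈ principalH ϖ ↔ ∃ B, mat A = 1 + ϖ • B := by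
  rw [principalH, Subgroup.mem_subgroupOf, MonoidHom.mem_ker]
  have key : ∀ x y : ZLam, Ideal.Quotient.mk (Ideal.span {ϖ}) x =
      Ideal.Quotient.mk (Ideal.span {ϖ}) y ↔ ∃ z, x = y + ϖ * z := by
    intro x y
    rw [Ideal.Quotient.eq, Ideal.mem_span_singleton]
    exact exists_congr fun z => by rw [sub_eq_iff_eq_add']
  constructor
  · intro h
    have h' : ∀ i j, ∃ z, mat A i j = (1 : Matrix (Fin 2) (Fin 2) ZLam) i j + ϖ * z := by
      intro i j
      rw [← key]
      have := congrArg (fun M : SL(2, _) => M.1 i j) h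
      refine this.trans ?_
      rcases eq_or_ne i j with rfl | hij
      · simp
      · simp [Matrix.one_apply_ne hij]
    choose z hz using h'
    exact ⟨Matrix.of z, by ext i j; simp [hz]⟩
  · rintro ⟨B, hB⟩
    ext i j
    have : Ideal.Quotient.mk (Ideal.span {ϖ}) (mat A i j) =
        Ideal.Quotient.mk (Ideal.span {ϖ}) ((1 : Matrix (Fin 2) (Fin 2) ZLam) i j) := by
      rw [key]
      exact ⟨B i j, by rw [hB]; simp⟩
    refine this.trans ?_
    rcases eq_or_ne i j with rfl | hij
    · simp
    · simp [Matrix.one_apply_ne hij]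

instance principalH_normal (ϖ : ZLam) : (principalH ϖ).Normal := by
  unfold principalH
  infer_instance

theorem principalH_le_of_dvd {ϖ τ : ZLam} (h : ϖ ∣ τ) : principalH τ ≤ principalH ϖ := by
  obtain ⟨c, rfl⟩ := h
  intro A hA
  obtain ⟨B, hB⟩ := mem_principalH.mp hA
  exact mem_principalH.mpr ⟨c • B, by rw [hB, smul_smul]⟩

theorem principalH_natCast_le {m n : ℕ} (h : m ∣ n) :
    principalH (n : ZLam) ≤ principalH (m : ZLam) :=
  principalH_le_of_dvd (Nat.cast_dvd_cast h)

theorem principalH_inf_le {a b n : ℕ} (hab : a.Coprime b) (h : n ∣ a * b) :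
    principalH (a : ZLam) ⊓ principalH (b : ZLam) ≤ principalH (n : ZLam) := by
  refine le_trans ?_ (principalH_natCast_le h)
  rintro A ⟨ha, hb⟩
  obtain ⟨B, hB⟩ := mem_principalH.mp ha
  obtain ⟨C, hC⟩ := mem_principalH.mp hb
  have hcop : IsCoprime (a : ZLam) (b : ZLam) := by
    simpa using (Nat.isCoprime_iff_coprime.mpr hab).map (Int.castRingHom ZLam)
  have : ∀ i j, ∃ z, mat A i j = (1 : Matrix (Fin 2) (Fin 2) ZLam) i j + (a * b : ℕ) * z := by
    intro i j
    have h1 : (a : ZLam) ∣ mat A i j - (1 : Matrix (Fin 2) (Fin 2) ZLam) i j :=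
      ⟨B i j, by rw [hB]; simp⟩
    have h2 : (b : ZLam) ∣ mat A i j - (1 : Matrix (Fin 2) (Fin 2) ZLam) i j :=
      ⟨C i j, by rw [hC]; simp⟩
    obtain ⟨z, hz⟩ := hcop.mul_dvd h1 h2
    exact ⟨z, by push_cast; rw [← hz]; ring⟩
  choose z hz using this
  exact mem_principalH.mpr ⟨Matrix.of z, by ext i j; simp [hz]⟩

/-- The normal closure of `T ^ m` in `H₅`. -/
def normalT (m : ℕ) : Subgroup H5 := Subgroup.normalClosure {T ^ m}

instance normalT_normal (m : ℕ) : (normalT m).Normal := Subgroup.normalClosure_normal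

theorem T_pow_mem_normalT (m : ℕ) : T ^ m ∈ normalT m :=
  Subgroup.subset_normalClosure (Set.mem_singleton _)

theorem normalT_le {m : ℕ} {N : Subgroup H5} [N.Normal] (h : T ^ m ∈ N) : normalT m ≤ N :=
  Subgroup.normalClosure_le_normal (Set.singleton_subset_iff.mpr h)

theorem normalT_le_of_dvd {m n : ℕ} (h : m ∣ n) : normalT n ≤ normalT m := by
  obtain ⟨c, rfl⟩ := h
  exact normalT_le (by rw [pow_mul]; exact pow_mem (T_pow_mem_normalT m) c)

theorem T_pow_mem_principalH (m : ℕ) : T ^ m ∈ principalH (m : ZLam) := by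
  refine mem_principalH.mpr ⟨!![0, lamZ; 0, 0], ?_⟩
  rw [mat_T_pow]
  ext i j
  fin_cases i <;> fin_cases j <;> simp

theorem normalT_le_principalH (m : ℕ) : normalT m ≤ principalH (m : ZLam) :=
  normalT_le (T_pow_mem_principalH m)

/-- By Bézout, T^gcd(a,b) is a power of T^a times a power of T^b, and T^b ≡ I mod b. This is how
level prime to a is removed. -/
theorem normalT_gcd_le (a b : ℕ) : normalT (a.gcd b) ≤ normalT a ⊔ principalH (b : ZLam) := by
  refine normalT_le ?_
  rw [← zpow_natCast, Nat.gcd_eq_gcd_ab, zpow_add, zpow_mul, zpow_mul, zpow_natCast, zpow_natCast]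
  exact mul_mem (zpow_mem (Subgroup.mem_sup_left (T_pow_mem_normalT a)) _)
    (zpow_mem (Subgroup.mem_sup_right (T_pow_mem_principalH b)) _)

/-! ### Linearization -/

/-- The matrices `A` for which some element of the normal closure of `T ^ M` is congruent to
`I + M A` modulo `M ^ 2`. -/
def linearPart (M : ℕ) : AddSubgroup (Matrix (Fin 2) (Fin 2) ZLam) where
  carrier := {A | ∃ g ∈ normalT M, ∃ X, mat g = 1 + (M : ZLam) • A + (M : ZLam) ^ 2 • X}
  zero_mem' := ⟨1, one_mem _, 0, by simp⟩
  add_mem' := by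
    rintro A B ⟨g, hg, X, hX⟩ ⟨h, hh, Y, hY⟩
    refine ⟨g * h, mul_mem hg hh,
      A * B + X + Y + (M : ZLam) • (A * Y + X * B) + (M : ZLam) ^ 2 • (X * Y), ?_⟩
    rw [map_mul, hX, hY]
    simp only [add_mul, mul_add, one_mul, mul_one, Matrix.smul_mul, Matrix.mul_smul, smul_add,
      smul_smul]
    module
  neg_mem' := by
    rintro A ⟨g, hg, X, hX⟩
    refine ⟨g⁻¹, inv_mem hg, mat g⁻¹ * (A * A - X + (M : ZLam) • (X * A)), ?_⟩
    have h1 : mat g⁻¹ * mat g = 1 := by rw [← map_mul, inv_mul_cancel, map_one]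
    have h2 : mat g * (1 + (M : ZLam) • (-A)) =
        1 - (M : ZLam) ^ 2 • (A * A - X + (M : ZLam) • (X * A)) := by
      rw [hX]
      simp only [add_mul, mul_add, one_mul, mul_one, Matrix.smul_mul, Matrix.mul_smul, smul_add,
        smul_smul, mul_neg, smul_neg]
      module
    have h3 := congrArg (mat g⁻¹ * ·) h2
    simp only [← mul_assoc, h1, one_mul, mul_sub, mul_one, Matrix.mul_smul] at h3
    rw [h3]
    simp

theorem smul_mem_linearPart (M : ℕ) (X : Matrix (Fin 2) (Fin 2) ZLam) :
    (M : ZLam) • X ∈ linearPart M :=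
  ⟨1, one_mem _, -X, by rw [map_one]; module⟩

theorem conj_mem_linearPart {M : ℕ} {A : Matrix (Fin 2) (Fin 2) ZLam} (hA : A ∈ linearPart M)
    (g : H5) : mat g * A * mat g⁻¹ ∈ linearPart M := by
  obtain ⟨h, hh, X, hX⟩ := hA
  refine ⟨g * h * g⁻¹, (normalT_normal M).conj_mem h hh g, mat g * X * mat g⁻¹, ?_⟩
  have h1 : mat g * mat g⁻¹ = 1 := by rw [← map_mul, mul_inv_cancel, map_one]
  rw [map_mul, map_mul, hX]
  simp only [add_mul, mul_add, mul_one, Matrix.smul_mul, Matrix.mul_smul, h1]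

theorem E_mem_linearPart (M : ℕ) : !![0, lamZ; 0, 0] ∈ linearPart M := by
  refine ⟨T ^ M, T_pow_mem_normalT M, 0, ?_⟩
  rw [mat_T_pow]
  ext i j
  fin_cases i <;> fin_cases j <;> simp

/-! ### Explicit conjugation by `S` and `T` -/

theorem mat_T_inv : mat T⁻¹ = !![1, -lamZ; 0, 1] := by
  rw [mat_inv, mat_T, Matrix.adjugate_fin_two_of, neg_zero]

theorem mat_S_inv : mat S⁻¹ = !![0, -1; 1, 0] := by
  rw [mat_inv, mat_S, Matrix.adjugate_fin_two_of, neg_neg]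

theorem fin_two_congr {R : Type*} {a b c d a' b' c' d' : R} (ha : a = a') (hb : b = b')
    (hc : c = c') (hd : d = d') : !![a, b; c, d] = !![a', b'; c', d'] := by
  rw [ha, hb, hc, hd]

section

variable {R : Type*} [CommRing R]

theorem conj_translation (l a b c d : R) :
    !![1, l; 0, 1] * !![a, b; c, d] * !![1, -l; 0, 1] =
      !![a + l * c, b + l * d - l * a - l ^ 2 * c; c, d - l * c] := by
  rw [Matrix.mul_fin_two, Matrix.mul_fin_two]
  apply fin_two_congr <;> ring

theorem conj_inversion (a b c d : R) :
    !![0, 1; -1, 0] * !![a, b; c, d] * !![0, -1; 1, 0] = !![d, -c; -b, a] := by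
  rw [Matrix.mul_fin_two, Matrix.mul_fin_two]
  apply fin_two_congr <;> ring

theorem fin_two_add (a b c d a' b' c' d' : R) :
    !![a, b; c, d] + !![a', b'; c', d'] = !![a + a', b + b'; c + c', d + d'] := by
  simp

theorem fin_two_sub (a b c d a' b' c' d' : R) :
    !![a, b; c, d] - !![a', b'; c', d'] = !![a - a', b - b'; c - c', d - d'] := by
  simp

theorem fin_two_zsmul (n : ℤ) (a b c d : R) :
    n • !![a, b; c, d] = !![n * a, n * b; n * c, n * d] := by
  simp

theorem fin_two_neg (a b c d : R) : -!![a, b; c, d] = !![-a, -b; -c, -d] := by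
  simp

end

theorem conj_S_mem_linearPart {M : ℕ} {a b c d : ZLam} (h : !![a, b; c, d] ∈ linearPart M) :
    !![d, -c; -b, a] ∈ linearPart M := by
  rw [← conj_inversion, ← mat_S, ← mat_S_inv]
  exact conj_mem_linearPart h S

theorem conj_T_mem_linearPart {M : ℕ} {a b c d : ZLam} (h : !![a, b; c, d] ∈ linearPart M) :
    !![a + lamZ * c, b + lamZ * d - lamZ * a - lamZ ^ 2 * c; c, d - lamZ * c] ∈ linearPart M := by
  rw [← conj_translation, ← mat_T, ← mat_T_inv]
  exact conj_mem_linearPart h T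

theorem conj_T_inv_mem_linearPart {M : ℕ} {a b c d : ZLam} (h : !![a, b; c, d] ∈ linearPart M) :
    !![a + -lamZ * c, b + -lamZ * d - -lamZ * a - (-lamZ) ^ 2 * c; c, d - -lamZ * c] ∈
      linearPart M := by
  rw [← conj_translation, neg_neg, ← mat_T, ← mat_T_inv]
  simpa using conj_mem_linearPart h T⁻¹

/-- The linear part contains λ in the upper corner, so multiples of 2λ; producing 2 as well gives
all of 2ℤ[λ]. -/
theorem two_upper_mem_linearPart (M : ℕ) (x : ZLam) : !![0, 2 * x; 0, 0] ∈ linearPart M := by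
  have hE := E_mem_linearPart M
  have hF := conj_S_mem_linearPart hE
  have hone : !![0, 2; 0, 0] ∈ linearPart M := by
    -- With F lower triangular of entry -λ, the second difference TFT⁻¹ + T⁻¹FT - 2F keeps only the
    -- quadratic term 2λ³ in the upper corner, and 2λ³ - 4λ = 2.
    have h := sub_mem (sub_mem (add_mem (conj_T_mem_linearPart hF) (conj_T_inv_mem_linearPart hF))
      (zsmul_mem hF 2)) (zsmul_mem hE 4)
    rw [fin_two_zsmul, fin_two_zsmul, fin_two_add, fin_two_sub, fin_two_sub] at h
    convert h using 1
    apply fin_two_congr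
    · push_cast; ring
    · push_cast; linear_combination (-2 * lamZ - 2) * lamZ_sq
    · push_cast; ring
    · push_cast; ring
  obtain ⟨a, b, rfl⟩ := exists_int_coords x
  have h := add_mem (zsmul_mem hone a) (zsmul_mem hE (2 * b))
  rw [fin_two_zsmul, fin_two_zsmul, fin_two_add] at h
  convert h using 1
  apply fin_two_congr <;> push_cast <;> ring

theorem two_lower_mem_linearPart (M : ℕ) (x : ZLam) : !![0, 0; 2 * x, 0] ∈ linearPart M := by
  have h := neg_mem (conj_S_mem_linearPart (two_upper_mem_linearPart M x))
  rw [fin_two_neg] at h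
  simpa only [neg_zero, neg_neg] using h

theorem two_diag_mem_linearPart (M : ℕ) (x : ZLam) : !![2 * x, 0; 0, -(2 * x)] ∈ linearPart M := by
  -- Since λ - 1 = λ⁻¹, conjugation by T turns this entry into 2x on the diagonal; the added upper
  -- matrix cancels the other new entry.
  have h0 := two_lower_mem_linearPart M (x * (lamZ - 1))
  have h := add_mem (sub_mem (conj_T_mem_linearPart h0) h0)
    (two_upper_mem_linearPart M (x * (lamZ - 1) * lamZ ^ 2))
  rw [fin_two_sub, fin_two_add] at h
  convert h using 1
  apply fin_two_congr
  · linear_combination (-2 * x) * lamZ_sq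
  · ring
  · ring
  · linear_combination (2 * x) * lamZ_sq

/-- A matrix 2B whose trace vanishes modulo M differs from a trace-zero one by a multiple of M,
which the linear part absorbs. -/
theorem two_smul_mem_linearPart {M : ℕ} {B : Matrix (Fin 2) (Fin 2) ZLam}
    (hB : ∃ y, 2 * (B 0 0 + B 1 1) = M * y) : (2 : ZLam) • B ∈ linearPart M := by
  obtain ⟨y, hy⟩ := hB
  have h := add_mem (add_mem (add_mem (two_upper_mem_linearPart M (B 0 1))
    (two_lower_mem_linearPart M (B 1 0))) (two_diag_mem_linearPart M (B 0 0)))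
    (smul_mem_linearPart M !![0, 0; 0, y])
  have hM : (M : ZLam) • !![0, 0; 0, y] = !![0, 0; 0, M * y] := by simp
  rw [hM, fin_two_add, fin_two_add, fin_two_add] at h
  convert h using 1
  rw [Matrix.eta_fin_two ((2 : ZLam) • B)]
  simp only [Matrix.smul_apply, smul_eq_mul]
  apply fin_two_congr
  · ring
  · ring
  · ring
  · linear_combination hy

/-- Choose h in the normal closure with the same linear part A. As cM divides M², g and h agree
modulo cM. -/
theorem mem_sup_of_linear {M c : ℕ} (hc : c ∣ M) {g : H5} {A : Matrix (Fin 2) (Fin 2) ZLam}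
    (hA : A ∈ linearPart M) (hg : ∃ X, mat g = 1 + (M : ZLam) • A + (c * M : ZLam) • X) :
    g ∈ normalT M ⊔ principalH ((c * M : ℕ) : ZLam) := by
  obtain ⟨h, hh, X, hX⟩ := hA
  obtain ⟨Y, hY⟩ := hg
  obtain ⟨d, rfl⟩ := hc
  refine Subgroup.mem_sup_of_normal_left.mpr ⟨h, hh, h⁻¹ * g, ?_, by group⟩
  refine mem_principalH.mpr ⟨mat h⁻¹ * (Y - (d : ZLam) • X), ?_⟩
  have h1 : mat h⁻¹ * mat h = 1 := by rw [← map_mul, inv_mul_cancel, map_one]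
  have h2 : mat g = mat h + ((c * (c * d) : ℕ) : ZLam) • (Y - (d : ZLam) • X) := by
    rw [hX, hY]
    push_cast
    module
  rw [map_mul, h2, mul_add, h1, Matrix.mul_smul]

/-- Expanding det(I + mB) = 1 gives m tr B + m² det B = 0: linear parts of congruence elements are
traceless modulo m. -/
theorem trace_of_congruent {g : H5} {m : ZLam} (hm : m ≠ 0) {B : Matrix (Fin 2) (Fin 2) ZLam}
    (hB : mat g = 1 + m • B) : B 0 0 + B 1 1 = m * (B 0 1 * B 1 0 - B 0 0 * B 1 1) := by
  have := mat_det_entries g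
  simp only [hB, Matrix.add_apply, Matrix.smul_apply, smul_eq_mul, Matrix.one_apply_eq,
    Matrix.one_apply_ne (show (0 : Fin 2) ≠ 1 by decide),
    Matrix.one_apply_ne (show (1 : Fin 2) ≠ 0 by decide)] at this
  refine mul_left_cancel₀ hm ?_
  linear_combination this

theorem principalH_two_mul_le {M : ℕ} (hM : M ≠ 0) :
    principalH ((2 * M : ℕ) : ZLam) ≤ normalT M ⊔ principalH ((M * M : ℕ) : ZLam) := by
  intro g hg
  obtain ⟨B, hB⟩ := mem_principalH.mp hg
  have ht := trace_of_congruent (by exact_mod_cast (by omega : 2 * M ≠ 0)) hB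
  refine mem_sup_of_linear dvd_rfl (A := (2 : ZLam) • B)
    (two_smul_mem_linearPart ⟨4 * (B 0 1 * B 1 0 - B 0 0 * B 1 1), ?_⟩) ⟨0, ?_⟩
  · rw [ht]; push_cast; ring
  · rw [hB]; push_cast; module

theorem principalH_le_of_odd {M s : ℕ} (hM : M ≠ 0) (hs : Odd s) (hsM : s ∣ M) :
    principalH (M : ZLam) ≤ normalT M ⊔ principalH ((s * M : ℕ) : ZLam) := by
  intro g hg
  obtain ⟨B, hB⟩ := mem_principalH.mp hg
  obtain ⟨k, hk⟩ := hs
  have ht := trace_of_congruent (by exact_mod_cast hM) hB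
  -- Here 2(k + 1) = s + 1, so this matrix is even and congruent to B modulo s: 2 is invertible
  -- modulo the odd s.
  have hmem : (2 : ZLam) • (((k + 1 : ℕ) : ZLam) • B) ∈ linearPart M := by
    refine two_smul_mem_linearPart ⟨2 * (k + 1) * (B 0 1 * B 1 0 - B 0 0 * B 1 1), ?_⟩
    simp only [Matrix.smul_apply, smul_eq_mul]
    push_cast
    linear_combination (2 * (k + 1) : ZLam) * ht
  refine mem_sup_of_linear hsM hmem ⟨-B, ?_⟩
  rw [hB, hk]
  push_cast
  module

/-- The modular law: as N(c) ≤ H(c), the left side is N(c)(H(c) ∩ H(b)), and the Chinese remainder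
theorem puts H(c) ∩ H(b) inside H(n). -/
theorem inf_sup_principalH_le {a b n : ℕ} (hab : a.Coprime b) (h : n ∣ a * b) {c : ℕ}
    (hac : a ∣ c) :
    principalH (c : ZLam) ⊓ (normalT c ⊔ principalH (b : ZLam)) ≤
      normalT c ⊔ principalH (n : ZLam) := by
  rintro g ⟨hg, hg'⟩
  obtain ⟨x, hx, y, hy, rfl⟩ := Subgroup.mem_sup_of_normal_left.mp hg'
  refine mul_mem (Subgroup.mem_sup_left hx) (Subgroup.mem_sup_right ?_)
  refine principalH_inf_le hab h ⟨principalH_natCast_le hac ?_, hy⟩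
  exact (Subgroup.mul_mem_cancel_left _ (normalT_le_principalH c hx)).mp hg

theorem exists_coprime_part (r : ℕ) {n : ℕ} (hn : n ≠ 0) :
    ∃ i b : ℕ, r.Coprime b ∧ n ∣ r ^ i * b := by
  induction n using Nat.strong_induction_on with
  | _ n ih =>
    by_cases h1 : r.Coprime n
    · exact ⟨0, n, h1, by simp⟩
    -- Each removal of gcd(r, n) from n costs one factor r.
    · obtain ⟨m, hm⟩ := Nat.gcd_dvd_right r n
      have hm0 : m ≠ 0 := by rintro rfl; simp at hm; exact hn hm
      have hg0 : r.gcd n ≠ 0 := by intro h0; rw [h0] at hm; simp at hm; exact hn hm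
      have hg1 : r.gcd n ≠ 1 := h1
      have hlt : m < n := by
        have : 2 * m ≤ r.gcd n * m := Nat.mul_le_mul_right _ (by omega)
        omega
      obtain ⟨i, b, hb, hd⟩ := ih m hlt hm0
      refine ⟨i + 1, b, hb, ?_⟩
      rw [hm, pow_succ', mul_assoc]
      exact Nat.mul_dvd_mul (Nat.gcd_dvd_left r n) hd

theorem principalH_le_iterate {M s : ℕ} (hM : M ≠ 0) (hs : Odd s) (hsM : s ∣ M) (i : ℕ) :
    principalH (M : ZLam) ≤ normalT M ⊔ principalH ((M * s ^ i : ℕ) : ZLam) := by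
  induction i with
  | zero => simp
  | succ i ih =>
    refine ih.trans (sup_le le_sup_left ?_)
    have hs0 : s ≠ 0 := hs.pos.ne'
    refine (principalH_le_of_odd (mul_ne_zero hM (pow_ne_zero i hs0)) hs
      (hsM.mul_right _)).trans (sup_le_sup (normalT_le_of_dvd (dvd_mul_right _ _)) ?_)
    exact principalH_natCast_le (dvd_of_eq (by ring))

/-! ### Words in a quotient of `C₂ * C₅` -/

section Words

variable {G : Type*} [Group G]

/-- The product of the elements `u ^ i * s` for `i` in a list. -/
def wordProd (u s : G) (l : List ℕ) : G := (l.map fun i => u ^ i * s).prod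

theorem wordProd_nil (u s : G) : wordProd u s [] = 1 := rfl

theorem wordProd_cons (u s : G) (i : ℕ) (l : List ℕ) :
    wordProd u s (i :: l) = u ^ i * s * wordProd u s l := by
  simp [wordProd]

theorem wordProd_append (u s : G) (l m : List ℕ) :
    wordProd u s (l ++ m) = wordProd u s l * wordProd u s m := by
  simp [wordProd]

theorem map_wordProd {H : Type*} [Group H] (f : G →* H) (u s : G) (l : List ℕ) :
    f (wordProd u s l) = wordProd (f u) (f s) l := by
  simp [wordProd, map_list_prod, List.map_map, Function.comp_def]

variable {u s : G}

theorem exists_word (hs : s * s = 1) (hu : u ^ 5 = 1) {g : G}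
    (hg : g ∈ Subgroup.closure {s, u}) :
    ∃ l : List ℕ, (∀ i ∈ l, 1 ≤ i ∧ i ≤ 4) ∧ ∃ x y : G, (x = 1 ∨ x = s) ∧ (y = 1 ∨ y = s) ∧
      g = x * wordProd u s l * y := by
  let P : G → Prop := fun g => ∃ l : List ℕ, (∀ i ∈ l, 1 ≤ i ∧ i ≤ 4) ∧ ∃ x y : G,
    (x = 1 ∨ x = s) ∧ (y = 1 ∨ y = s) ∧ g = x * wordProd u s l * y
  have hPs : ∀ g, P g → P (s * g) := by
    rintro _ ⟨l, hl, x, y, rfl | rfl, hy, rfl⟩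
    · exact ⟨l, hl, s, y, Or.inr rfl, hy, by group⟩
    · exact ⟨l, hl, 1, y, Or.inl rfl, hy, by simp only [← mul_assoc, hs]⟩
  have hPu : ∀ g, P g → P (u * g) := by
    rintro _ ⟨l, hl, x, y, rfl | rfl, hy, rfl⟩
    · rcases l with _ | ⟨i, l⟩
      · rcases hy with rfl | rfl
        · exact ⟨[1], by simp, 1, s, Or.inl rfl, Or.inr rfl, by
            simp [wordProd_cons, wordProd_nil, mul_assoc, hs]⟩
        · exact ⟨[1], by simp, 1, 1, Or.inl rfl, Or.inl rfl, by
            simp [wordProd_cons, wordProd_nil]⟩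
      · have hi := hl i (by simp)
        rcases Nat.lt_or_ge i 4 with h4 | h4
        · refine ⟨(i + 1) :: l, ?_, 1, y, Or.inl rfl, hy, ?_⟩
          · intro j hj
            rcases List.mem_cons.mp hj with rfl | hj
            · omega
            · exact hl j (List.mem_cons_of_mem _ hj)
          · rw [wordProd_cons, wordProd_cons, pow_succ' u i]
            group
        · obtain rfl : i = 4 := by omega
          refine ⟨l, fun j hj => hl j (List.mem_cons_of_mem _ hj), s, y, Or.inr rfl, hy, ?_⟩
          have : u * (u ^ 4 * s) = s := by rw [← mul_assoc, ← pow_succ', hu, one_mul]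
          rw [wordProd_cons, one_mul, ← mul_assoc, ← mul_assoc, this]
    · refine ⟨1 :: l, ?_, 1, y, Or.inl rfl, hy, ?_⟩
      · intro j hj
        rcases List.mem_cons.mp hj with rfl | hj
        · omega
        · exact hl j hj
      · rw [wordProd_cons]
        group
  have hsi : s⁻¹ = s := inv_eq_of_mul_eq_one_right hs
  have hui : u⁻¹ = u ^ 4 := inv_eq_of_mul_eq_one_right (by rw [← pow_succ', hu])
  refine Subgroup.closure_induction_left (p := fun g _ => P g)
    ⟨[], by simp, 1, 1, Or.inl rfl, Or.inl rfl, by simp [wordProd_nil]⟩ ?_ ?_ hg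
  · rintro x (rfl | rfl) y - hy
    · exact hPs y hy
    · exact hPu y hy
  · rintro x (rfl | rfl) y - hy
    · rw [hsi]
      exact hPs y hy
    · rw [hui]
      have : x ^ 4 * y = x * (x * (x * (x * y))) := by
        simp only [pow_succ, pow_zero, one_mul, mul_assoc]
      rw [this]
      exact hPu _ (hPu _ (hPu _ (hPu _ hy)))

theorem isConj_mul_comm (a b : G) : IsConj (a * b) (b * a) :=
  isConj_iff.mpr ⟨b, by group⟩

/-- Cyclic reduction: moving the last letter u^j s to the front cancels s² and merges u^j with u^i.
If u^(i+j) = 1, a shorter word of the same shape remains; otherwise the leading s is gone. -/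
theorem isConj_s_mul_word (hs : s * s = 1) (hu : u ^ 5 = 1) (n : ℕ) :
    ∀ l : List ℕ, l.length = n → (∀ i ∈ l, 1 ≤ i ∧ i ≤ 4) →
      (∃ m : List ℕ, (∀ i ∈ m, 1 ≤ i ∧ i ≤ 4) ∧ IsConj (s * wordProd u s l) (wordProd u s m)) ∨
        IsConj (s * wordProd u s l) s ∨ ∃ j : ℕ, IsConj (s * wordProd u s l) (u ^ j) := by
  induction n using Nat.strong_induction_on with
  | _ n ih =>
    intro l hn hl
    rcases l with _ | ⟨i, l⟩
    · exact Or.inr (Or.inl (by rw [wordProd_nil, mul_one]))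
    rcases List.eq_nil_or_concat l with rfl | ⟨m, j, rfl⟩
    · refine Or.inr (Or.inr ⟨i, ?_⟩)
      rw [wordProd_cons, wordProd_nil, mul_one]
      refine (isConj_mul_comm _ _).trans ?_
      rw [mul_assoc, hs, mul_one]
    rw [List.concat_eq_append] at hn hl ⊢
    have hm : ∀ k ∈ m, 1 ≤ k ∧ k ≤ 4 := fun k hk => hl k (by simp [hk])
    have hi := hl i (by simp)
    have hj := hl j (by simp)
    have hconj : IsConj (s * wordProd u s (i :: (m ++ [j])))
        (u ^ (i + j) * s * wordProd u s m) := by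
      have e : s * wordProd u s (i :: (m ++ [j])) =
          (s * u ^ i * s * wordProd u s m) * (u ^ j * s) := by
        rw [wordProd_cons, wordProd_append, wordProd_cons, wordProd_nil]
        group
      rw [e]
      refine (isConj_mul_comm _ _).trans ?_
      have e' : u ^ j * s * (s * u ^ i * s * wordProd u s m) =
          u ^ j * (s * s) * u ^ i * s * wordProd u s m := by group
      rw [e', hs, mul_one, ← pow_add, add_comm j]
    by_cases h5 : (i + j) % 5 = 0
    · have e : u ^ (i + j) = 1 := by
        rw [← Nat.div_add_mod (i + j) 5, h5, add_zero, pow_mul, hu, one_pow]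
      rw [e, one_mul] at hconj
      rcases ih m.length (by simp at hn; omega) m rfl hm with ⟨m', h1, h2⟩ | h | ⟨k, h⟩
      · exact Or.inl ⟨m', h1, hconj.trans h2⟩
      · exact Or.inr (Or.inl (hconj.trans h))
      · exact Or.inr (Or.inr ⟨k, hconj.trans h⟩)
    · refine Or.inl ⟨(i + j) % 5 :: m, ?_, ?_⟩
      · intro k hk
        rcases List.mem_cons.mp hk with rfl | hk
        · omega
        · exact hm k hk
      · rwa [wordProd_cons u s (_ % 5), ← pow_eq_pow_mod _ hu]

theorem isConj_word (hs : s * s = 1) (hu : u ^ 5 = 1) {g : G}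
    (hg : g ∈ Subgroup.closure {s, u}) :
    (∃ m : List ℕ, (∀ i ∈ m, 1 ≤ i ∧ i ≤ 4) ∧ IsConj g (wordProd u s m)) ∨
      IsConj g s ∨ ∃ j : ℕ, IsConj g (u ^ j) := by
  obtain ⟨l, hl, x, y, hx, hy, rfl⟩ := exists_word hs hu hg
  have hconj : IsConj (x * wordProd u s l * y) (y * x * wordProd u s l) := by
    rw [mul_assoc y]
    exact isConj_mul_comm _ _
  have hyx : y * x = 1 ∨ y * x = s := by
    rcases hx with rfl | rfl <;> rcases hy with rfl | rfl <;> simp [hs]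
  rcases hyx with h | h <;> rw [h] at hconj
  · exact Or.inl ⟨l, hl, by rwa [one_mul] at hconj⟩
  · rcases isConj_s_mul_word hs hu _ l rfl hl with ⟨m', h1, h2⟩ | h | ⟨k, h⟩
    · exact Or.inl ⟨m', h1, hconj.trans h2⟩
    · exact Or.inr (Or.inl (hconj.trans h))
    · exact Or.inr (Or.inr ⟨k, hconj.trans h⟩)

theorem exists_pow_mul_pow (hs : s * s = 1) (hu : u ^ 5 = 1) (hsu : s * u = u ^ 4 * s) {g : G}
    (hg : g ∈ Subgroup.closure {s, u}) : ∃ a b : ℕ, g = u ^ a * s ^ b := by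
  have hsi : s⁻¹ = s := inv_eq_of_mul_eq_one_right hs
  have hui : u⁻¹ = u ^ 4 := inv_eq_of_mul_eq_one_right (by rw [← pow_succ', hu])
  have hPs : ∀ a b : ℕ, s * (u ^ a * s ^ b) = u ^ (4 * a) * s ^ (b + 1) := by
    intro a b
    have h : SemiconjBy s (u ^ a) ((u ^ 4) ^ a) := SemiconjBy.pow_right hsu a
    rw [← mul_assoc, h.eq, pow_mul, pow_succ' s b, mul_assoc]
  refine Subgroup.closure_induction_left (p := fun g _ => ∃ a b : ℕ, g = u ^ a * s ^ b)
    ⟨0, 0, by simp⟩ ?_ ?_ hg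
  · rintro x (rfl | rfl) _ - ⟨a, b, rfl⟩
    · exact ⟨_, _, hPs a b⟩
    · exact ⟨a + 1, b, by rw [pow_succ', mul_assoc]⟩
  · rintro x (rfl | rfl) _ - ⟨a, b, rfl⟩
    · rw [hsi]
      exact ⟨_, _, hPs a b⟩
    · rw [hui]
      exact ⟨4 + a, b, by rw [pow_add, mul_assoc]⟩

/-- In a quotient of the binary analogue of `C₂ * C₅` in which `(u s) ^ 2 = 1`, the central
involution `s ^ 2 = u ^ 5` is trivial. -/
theorem central_eq_one {z : G} (hs : s * s = z) (hu : u ^ 5 = z) (hz : z * z = 1)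
    (hus : u * s * (u * s) = 1) : z = 1 := by
  have hzu : Commute u⁻¹ z := by
    rw [← hu]
    exact (Commute.refl u).inv_left.pow_right 5
  have hsi : s⁻¹ = z * s := inv_eq_of_mul_eq_one_left (by rw [mul_assoc, hs, hz])
  have h1 : SemiconjBy s u (u⁻¹ * z) := by
    have h : s * u = u⁻¹ * s⁻¹ := by
      rw [eq_comm, ← mul_inv_rev, inv_eq_iff_mul_eq_one]
      have : s * u * (s * u) = u⁻¹ * (u * s * (u * s)) * u := by group
      rw [this, hus]
      group
    rw [SemiconjBy, h, hsi, mul_assoc]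
  -- Conjugation by s sends u to u⁻¹z; its fifth power sends z = u⁵ to z⁻¹z⁵ = 1.
  have h2 := (h1.pow_right 5).eq
  rw [hu, hzu.mul_pow, inv_pow, hu, show 5 = 1 + 2 + 2 from rfl, pow_add, pow_add, pow_two, hz,
    pow_one, mul_one, mul_one, inv_mul_cancel, one_mul] at h2
  exact mul_eq_left.mp h2

end Words

/-! ### The element of order five -/

/-- The product `T * S⁻¹`, whose fifth power is `-I`. -/
def U : H5 := T * S⁻¹

/-- The matrix `-I` as an element of `H₅`. -/
def negOne : H5 := ⟨-1, neg_one_mem_H5⟩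

theorem mat_negOne : mat negOne = -1 := rfl

theorem mat_U : mat U = !![lamZ, -1; 1, 0] := by
  rw [U, map_mul, mat_T, mat_S_inv, Matrix.mul_fin_two]
  apply fin_two_congr <;> ring

theorem mat_U_sq : mat (U ^ 2) = !![lamZ, -lamZ; lamZ, -1] := by
  rw [pow_two, map_mul, mat_U, Matrix.mul_fin_two]
  apply fin_two_congr
  · linear_combination lamZ_sq
  all_goals ring

theorem mat_U_cube : mat (U ^ 3) = !![1, -lamZ; lamZ, -lamZ] := by
  rw [pow_succ, map_mul, mat_U_sq, mat_U, Matrix.mul_fin_two]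
  apply fin_two_congr
  · linear_combination lamZ_sq
  · ring
  · linear_combination lamZ_sq
  · ring

theorem mat_U_four : mat (U ^ 4) = !![0, -1; 1, -lamZ] := by
  rw [pow_succ, map_mul, mat_U_cube, mat_U, Matrix.mul_fin_two]
  apply fin_two_congr
  · ring
  · ring
  · linear_combination lamZ_sq
  · ring

theorem S_mul_S : S * S = negOne := by
  apply mat_injective
  rw [map_mul, mat_S, mat_negOne, Matrix.mul_fin_two, Matrix.one_fin_two, fin_two_neg]
  apply fin_two_congr <;> ring

theorem U_pow_five : U ^ 5 = negOne := by
  apply mat_injective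
  rw [pow_succ, map_mul, mat_U_four, mat_U, mat_negOne, Matrix.mul_fin_two, Matrix.one_fin_two,
    fin_two_neg]
  apply fin_two_congr <;> ring

theorem mat_mul_S (g : H5) :
    mat (g * S) = !![-mat g 0 1, mat g 0 0; -mat g 1 1, mat g 1 0] := by
  rw [map_mul, mat_S, Matrix.eta_fin_two (mat g), Matrix.mul_fin_two]
  simp

theorem mat_S_mul (g : H5) :
    mat (S * g) = !![mat g 1 0, mat g 1 1; -mat g 0 0, -mat g 0 1] := by
  rw [map_mul, mat_S, Matrix.eta_fin_two (mat g), Matrix.mul_fin_two]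
  simp

theorem U_mul_S : U * S = T := by rw [U, inv_mul_cancel_right]

theorem closure_S_T : Subgroup.closure {S, T} = (⊤ : Subgroup H5) := by
  have h := Subgroup.closure_closure_coe_preimage (k := ({matS, matT} : Set SL(2, ZLam)))
  refine Eq.trans (congrArg _ ?_) h
  ext x
  simp only [Set.mem_insert_iff, Set.mem_singleton_iff]
  exact or_congr (Subtype.ext_iff) (Subtype.ext_iff)

theorem closure_S_U : Subgroup.closure {S, U} = (⊤ : Subgroup H5) := by
  rw [eq_top_iff, ← closure_S_T, Subgroup.closure_le]
  have hS : S ∈ Subgroup.closure {S, U} := Subgroup.subset_closure (by simp)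
  have hU : U ∈ Subgroup.closure {S, U} := Subgroup.subset_closure (by simp)
  rintro x (rfl | rfl)
  · exact hS
  · rw [← U_mul_S]
    exact mul_mem hU hS

/-! ### The principal congruence subgroup of level two -/

theorem not_two_dvd_one : ¬ (2 : ZLam) ∣ 1 := by
  rintro ⟨c, hc⟩
  obtain ⟨a, b, rfl⟩ := exists_int_coords c
  have := (eq_zero_of_coords (a := 1 - 2 * a) (b := -(2 * b)) (by
    push_cast; linear_combination hc)).1
  omega

theorem not_two_dvd_lamZ : ¬ (2 : ZLam) ∣ lamZ := by
  rintro ⟨c, hc⟩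
  obtain ⟨a, b, rfl⟩ := exists_int_coords c
  have := (eq_zero_of_coords (a := -(2 * a)) (b := 1 - 2 * b) (by
    push_cast; linear_combination hc)).2
  omega

/-- Killing T makes U = S⁻¹, so U⁵ = S² becomes S⁷ = 1; with S⁴ = 1 this kills S. -/
theorem normalT_one : normalT 1 = ⊤ := by
  have hT : T ∈ normalT 1 := by simpa using T_pow_mem_normalT 1
  have hmem : ∀ x, x ∈ normalT 1 ↔ QuotientGroup.mk' (normalT 1) x = 1 := fun x =>
    (QuotientGroup.eq_one_iff x).symm
  set φ := QuotientGroup.mk' (normalT 1)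
  have hUS : φ U = (φ S)⁻¹ := by
    rw [U, map_mul, (hmem T).mp hT, one_mul, map_inv]
  have h3 : φ S ^ 7 = 1 := by
    have h := congrArg φ (U_pow_five.trans S_mul_S.symm)
    rw [map_pow, hUS, map_mul, inv_pow, inv_eq_iff_mul_eq_one] at h
    rw [← h]
    group
  have h4 : φ S ^ 4 = 1 := by
    have h : S ^ 4 = 1 := by
      apply mat_injective
      rw [show 4 = 2 * 2 from rfl, pow_mul, pow_two S, S_mul_S, pow_two, map_mul, mat_negOne]
      simp
    rw [← map_pow, h, map_one]
  have hS : φ S = 1 := by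
    have e : φ S = (φ S ^ 4) ^ 2 * (φ S ^ 7)⁻¹ := by group
    rw [e, h3, h4]
    simp
  rw [eq_top_iff, ← closure_S_T, Subgroup.closure_le]
  rintro x (rfl | rfl)
  · exact (hmem _).mpr hS
  · exact hT

theorem eq_one_of_mem_principalH_two {a b : ℕ} (ha : a < 5) (hb : b < 2)
    (h : U ^ a * S ^ b ∈ principalH ((2 : ℕ) : ZLam)) : a = 0 ∧ b = 0 := by
  obtain ⟨B, hB⟩ := mem_principalH.mp h
  have h01 : (2 : ZLam) ∣ mat (U ^ a * S ^ b) 0 1 := ⟨B 0 1, by rw [hB]; simp⟩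
  have h10 : (2 : ZLam) ∣ mat (U ^ a * S ^ b) 1 0 := ⟨B 1 0, by rw [hB]; simp⟩
  clear hB
  have n1 := not_two_dvd_one
  have nl := not_two_dvd_lamZ
  interval_cases b
  · rw [pow_zero, mul_one] at h01 h10
    interval_cases a
    · simp
    · rw [pow_one, mat_U] at h10; exact absurd h10 n1
    · rw [mat_U_sq] at h10; exact absurd h10 nl
    · rw [mat_U_cube] at h10; exact absurd h10 nl
    · rw [mat_U_four] at h10; exact absurd h10 n1
  · rw [pow_one, mat_mul_S] at h01 h10
    interval_cases a
    · rw [pow_zero, map_one] at h01; exact absurd h01 n1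
    · rw [pow_one, mat_U] at h01; exact absurd h01 nl
    · rw [mat_U_sq] at h10; exact absurd h10 (by simpa using n1)
    · rw [mat_U_cube] at h10; exact absurd h10 (by simpa using nl)
    · rw [mat_U_four] at h10; exact absurd h10 (by simpa using nl)

/-- Modulo N(2) the relation (US)² = 1 first kills -I and then makes S invert U, so the ten elements
U^a S^b represent the whole quotient. Only the trivial one is congruent to I modulo 2. -/
theorem principalH_two_le : principalH ((2 : ℕ) : ZLam) ≤ normalT 2 := by
  intro g hg
  have hmem : ∀ x, x ∈ normalT 2 ↔ QuotientGroup.mk' (normalT 2) x = 1 := fun x =>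
    (QuotientGroup.eq_one_iff x).symm
  set φ := QuotientGroup.mk' (normalT 2) with hφ
  have hus : φ U * φ S * (φ U * φ S) = 1 := by
    rw [← map_mul, ← map_mul, U_mul_S, ← pow_two]
    exact (hmem _).mp (T_pow_mem_normalT 2)
  have hzz : φ negOne * φ negOne = 1 := by
    have h : negOne * negOne = 1 := mat_injective (by rw [map_mul, mat_negOne]; simp)
    rw [← map_mul, h, map_one]
  have hs : φ S * φ S = φ negOne := by rw [← map_mul, S_mul_S]
  have hu : φ U ^ 5 = φ negOne := by rw [← map_pow, U_pow_five]
  have hz : φ negOne = 1 := central_eq_one hs hu hzz hus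
  rw [hz] at hs hu
  have hsu : φ S * φ U = φ U ^ 4 * φ S := by
    have hui : (φ U)⁻¹ = φ U ^ 4 := inv_eq_of_mul_eq_one_right (by rw [← pow_succ', hu])
    have hsi : (φ S)⁻¹ = φ S := inv_eq_of_mul_eq_one_right hs
    rw [← hui]
    nth_rw 2 [← hsi]
    rw [eq_comm, ← mul_inv_rev, inv_eq_iff_mul_eq_one]
    have : φ S * φ U * (φ S * φ U) = (φ U)⁻¹ * (φ U * φ S * (φ U * φ S)) * φ U := by group
    rw [this, hus]
    group
  have hcl : φ g ∈ Subgroup.closure {φ S, φ U} := by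
    rw [← Set.image_pair, ← MonoidHom.map_closure, closure_S_U]
    exact ⟨g, trivial, rfl⟩
  obtain ⟨a, b, hab⟩ := exists_pow_mul_pow hs hu hsu hcl
  rw [pow_eq_pow_mod a hu,
    pow_eq_pow_mod b ((pow_two _).trans hs), ← map_pow, ← map_pow, ← map_mul] at hab
  have hd : g * (U ^ (a % 5) * S ^ (b % 2))⁻¹ ∈ normalT 2 := by
    rw [hmem, map_mul, map_inv, hab, mul_inv_cancel]
  have hd' := normalT_le_principalH 2 hd
  rw [Subgroup.mul_mem_cancel_left _ hg, inv_mem_iff] at hd'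
  obtain ⟨ha, hb⟩ := eq_one_of_mem_principalH_two (Nat.mod_lt _ (by norm_num))
    (Nat.mod_lt _ (by norm_num)) hd'
  rw [ha, hb] at hd
  simpa using hd

/-! ### Principal congruence subgroups and normal closures of powers of `T` -/

theorem principalH_le_of_odd_level {r n : ℕ} (hr : Odd r) (hn : n ≠ 0) :
    principalH (r : ZLam) ≤ normalT r ⊔ principalH (n : ZLam) := by
  obtain ⟨i, b, hb, hd⟩ := exists_coprime_part r hn
  refine (principalH_le_iterate hr.pos.ne' hr dvd_rfl i).trans (sup_le le_sup_left ?_)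
  have hcop : (r * r ^ i).Coprime b := by rw [← pow_succ']; exact hb.pow_left _
  have h1 : normalT (r * r ^ i) ⊔ principalH (b : ZLam) = ⊤ := by
    have h := normalT_gcd_le (r * r ^ i) b
    rwa [hcop.gcd_eq_one, normalT_one, top_le_iff] at h
  have h2 := inf_sup_principalH_le hcop (hd.trans (by rw [mul_assoc]; exact dvd_mul_left _ _))
    (dvd_refl (r * r ^ i))
  rw [h1, inf_top_eq] at h2
  exact h2.trans (sup_le_sup_right (normalT_le_of_dvd (dvd_mul_right _ _)) _)

theorem principalH_le_of_two_mul_odd_level {s n : ℕ} (hs : Odd s) (hn : n ≠ 0) :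
    principalH ((2 * s : ℕ) : ZLam) ≤ normalT (2 * s) ⊔ principalH (n : ZLam) := by
  obtain ⟨i, b, hb, hd⟩ := exists_coprime_part s hn
  refine (principalH_le_iterate (mul_ne_zero two_ne_zero hs.pos.ne') hs
    (dvd_mul_left _ _) i).trans (sup_le le_sup_left ?_)
  have hcop : (s * s ^ i).Coprime b := by rw [← pow_succ']; exact hb.pow_left _
  have e : 2 * s * s ^ i = 2 * (s * s ^ i) := by ring
  -- The cofactor b may be even, so the gcd is taken with 2b, where it is exactly 2; H(2) ≤ N(2)
  -- then replaces N(1) = H₅.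
  have h1 : normalT 2 ≤ normalT (2 * s * s ^ i) ⊔ principalH (b : ZLam) := by
    have h := normalT_gcd_le (2 * (s * s ^ i)) (2 * b)
    rw [Nat.gcd_mul_left, hcop.gcd_eq_one, mul_one, ← e] at h
    exact h.trans (sup_le_sup_left (principalH_natCast_le (dvd_mul_left _ _)) _)
  have h2 := inf_sup_principalH_le hcop (hd.trans (by rw [mul_assoc]; exact dvd_mul_left _ _))
    (show s * s ^ i ∣ 2 * s * s ^ i by rw [e]; exact dvd_mul_left _ _)
  have h3 : principalH ((2 * s * s ^ i : ℕ) : ZLam) ≤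
      normalT (2 * s * s ^ i) ⊔ principalH (b : ZLam) :=
    (principalH_natCast_le (by rw [e]; exact dvd_mul_right _ _)).trans
      (principalH_two_le.trans h1)
  rw [inf_eq_left.mpr h3] at h2
  exact h2.trans (sup_le_sup_right (normalT_le_of_dvd (dvd_mul_right _ _)) _)

/-- With M = 4q(2q)^i, the next modulus 2(2qM) = 4qM still divides M². The divisibility of the level
by 4 thus pays for the factor 2 lost at each stage and still gains powers of 2. -/
theorem principalH_two_mul_le_iterate {q : ℕ} (hq : q ≠ 0) (i : ℕ) :
    principalH ((2 * (4 * q) : ℕ) : ZLam) ≤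
      normalT (4 * q) ⊔ principalH ((2 * (4 * q * (2 * q) ^ i) : ℕ) : ZLam) := by
  induction i with
  | zero => simp
  | succ i ih =>
    refine ih.trans (sup_le le_sup_left ?_)
    refine (principalH_two_mul_le (by positivity)).trans
      (sup_le_sup (normalT_le_of_dvd (dvd_mul_right _ _)) (principalH_natCast_le ?_))
    exact ⟨(2 * q) ^ i, by ring⟩

theorem principalH_le_of_four_mul_level {q n : ℕ} (hq : q ≠ 0) (hn : n ≠ 0) :
    principalH ((2 * (4 * q) : ℕ) : ZLam) ≤ normalT (4 * q) ⊔ principalH (n : ZLam) := by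
  obtain ⟨i, b, hb, hd⟩ := exists_coprime_part (2 * q) hn
  refine (principalH_two_mul_le_iterate hq i).trans (sup_le le_sup_left ?_)
  set c := 2 * (4 * q * (2 * q) ^ i) with hc
  have hcop : c.Coprime b := by
    have h2 : Nat.Coprime 2 b := hb.coprime_dvd_left (dvd_mul_right _ _)
    have e : c = 2 * 2 * ((2 * q) * (2 * q) ^ i) := by rw [hc]; ring
    rw [e]
    exact (h2.mul_left h2).mul_left (hb.mul_left (hb.pow_left _))
  have h1 : normalT c ⊔ principalH (b : ZLam) = ⊤ := by
    have h := normalT_gcd_le c b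
    rwa [hcop.gcd_eq_one, normalT_one, top_le_iff] at h
  have h2 := inf_sup_principalH_le hcop
    (hd.trans (Nat.mul_dvd_mul_right ⟨8 * q, by rw [hc]; ring⟩ b)) (dvd_refl c)
  rw [h1, inf_top_eq] at h2
  exact h2.trans (sup_le_sup_right (normalT_le_of_dvd ⟨2 * (2 * q) ^ i, by rw [hc]; ring⟩) _)

/-! ### Real entries -/

/-- The entries of an element of `H₅`, as real numbers. -/
def ent (g : H5) (i j : Fin 2) : ℝ := (mat g i j : ZLam)

theorem ent_mul (g h : H5) (i j : Fin 2) :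
    ent (g * h) i j = ent g i 0 * ent h 0 j + ent g i 1 * ent h 1 j := by
  simp [ent, Matrix.mul_apply, Fin.sum_univ_two]

theorem ent_negOne_mul (g : H5) (i j : Fin 2) : ent (negOne * g) i j = -ent g i j := by
  simp [ent, mat_negOne]

theorem ent_det (g : H5) : ent g 0 0 * ent g 1 1 - ent g 0 1 * ent g 1 0 = 1 := by
  have h := congrArg Subtype.val (mat_det_entries g)
  simpa [ent] using h

theorem toGL_apply (g : H5) (i j : Fin 2) : toGL g i j = ent g i j := rfl

/-- Nonnegative matrices whose entries vanish or are at least one. -/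
structure IsPositive (g : H5) : Prop where
  a : 1 ≤ ent g 0 0
  b : ent g 0 1 = 0 ∨ 1 ≤ ent g 0 1
  c : ent g 1 0 = 0 ∨ 1 ≤ ent g 1 0
  d : 1 ≤ ent g 1 1

theorem IsPositive.b_nonneg {g : H5} (hg : IsPositive g) : 0 ≤ ent g 0 1 := by
  rcases hg.b with h | h <;> linarith

theorem IsPositive.c_nonneg {g : H5} (hg : IsPositive g) : 0 ≤ ent g 1 0 := by
  rcases hg.c with h | h <;> linarith

theorem isPositive_one : IsPositive 1 where
  a := by simp [ent]
  b := by simp [ent]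
  c := by simp [ent]
  d := by simp [ent]

theorem IsPositive.mul {g h : H5} (hg : IsPositive g) (hh : IsPositive h) :
    IsPositive (g * h) where
  a := by
    rw [ent_mul]
    nlinarith [hg.a, hh.a, mul_nonneg hg.b_nonneg hh.c_nonneg]
  b := by
    rw [ent_mul]
    have h1 := mul_nonneg (zero_le_one.trans hg.a) hh.b_nonneg
    have h2 := mul_nonneg hg.b_nonneg (zero_le_one.trans hh.d)
    rcases hg.b with h | h
    · rcases hh.b with h' | h'
      · simp [h, h']
      · right; nlinarith [hg.a]
    · right; nlinarith [hh.d]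
  c := by
    rw [ent_mul]
    have h1 := mul_nonneg hg.c_nonneg (zero_le_one.trans hh.a)
    have h2 := mul_nonneg (zero_le_one.trans hg.d) hh.c_nonneg
    rcases hg.c with h | h
    · rcases hh.c with h' | h'
      · simp [h, h']
      · right; nlinarith [hg.d]
    · right; nlinarith [hh.a]
  d := by
    rw [ent_mul]
    nlinarith [hg.d, hh.d, mul_nonneg hg.c_nonneg hh.b_nonneg]

theorem mat_letter_two : mat (U ^ 2 * S) = !![lamZ, lamZ; 1, lamZ] := by
  rw [mat_mul_S, mat_U_sq]
  apply fin_two_congr <;> simp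

theorem mat_letter_three : mat (U ^ 3 * S) = !![lamZ, 1; lamZ, lamZ] := by
  rw [mat_mul_S, mat_U_cube]
  apply fin_two_congr <;> simp

theorem mat_letter_four : mat (U ^ 4 * S) = !![1, 0; lamZ, 1] := by
  rw [mat_mul_S, mat_U_four]
  apply fin_two_congr <;> simp

theorem coe_lamZ : (lamZ : ℝ) = lam := rfl

theorem isPositive_letter {i : ℕ} (hi : 1 ≤ i ∧ i ≤ 4) : IsPositive (U ^ i * S) := by
  have h := one_lt_lam
  obtain ⟨h1, h4⟩ := hi
  interval_cases i
  · rw [pow_one, U_mul_S]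
    constructor <;> simp [ent, mat_T, coe_lamZ, h.le]
  · constructor <;> simp [ent, mat_letter_two, coe_lamZ, h.le]
  · constructor <;> simp [ent, mat_letter_three, coe_lamZ, h.le]
  · constructor <;> simp [ent, mat_letter_four, coe_lamZ, h.le]

theorem isPositive_word {l : List ℕ} (hl : ∀ i ∈ l, 1 ≤ i ∧ i ≤ 4) :
    IsPositive (wordProd U S l) := by
  induction l with
  | nil => exact isPositive_one
  | cons i l ih =>
    rw [wordProd_cons]
    exact (isPositive_letter (hl i (by simp))).mul (ih fun j hj => hl j (by simp [hj]))

/-! ### The quotient `G₅` -/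

theorem mem_Z {g : H5} : g ∈ Z ↔ g = 1 ∨ g = negOne := by
  have hsq : negOne ^ 2 = 1 := mat_injective (by rw [map_pow, mat_negOne]; simp)
  constructor
  · rintro ⟨k, rfl⟩
    change negOne ^ k = 1 ∨ negOne ^ k = negOne
    rcases Int.even_or_odd' k with ⟨j, rfl | rfl⟩
    · left
      rw [zpow_mul, zpow_ofNat, hsq, one_zpow]
    · right
      rw [zpow_add, zpow_mul, zpow_ofNat, hsq, one_zpow, one_mul, zpow_one]
  · rintro (rfl | rfl)
    · exact one_mem _
    · exact Subgroup.mem_zpowers _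

theorem negOne_mul_comm (g : H5) : negOne * g = g * negOne :=
  mat_injective (by rw [map_mul, map_mul, mat_negOne]; simp)

theorem mk_eq_mk_iff {g h : H5} : (g : G5) = h ↔ g = h ∨ g = negOne * h := by
  rw [eq_comm, QuotientGroup.eq, mem_Z]
  refine or_congr ?_ ?_
  · rw [inv_mul_eq_one, eq_comm]
  · rw [inv_mul_eq_iff_eq_mul, negOne_mul_comm]

theorem mk_negOne : (negOne : G5) = 1 :=
  (QuotientGroup.eq_one_iff _).mpr (mem_Z.mpr (Or.inr rfl))

theorem mk_S_mul_self : (S : G5) * S = 1 := by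
  rw [← QuotientGroup.mk_mul, S_mul_S, mk_negOne]

theorem mk_U_pow_five : (U : G5) ^ 5 = 1 := by
  rw [← QuotientGroup.mk_pow, U_pow_five, mk_negOne]

theorem mk_mem_closure (g : H5) : (g : G5) ∈ Subgroup.closure {(S : G5), (U : G5)} := by
  have h : Subgroup.closure {(S : G5), (U : G5)} =
      (Subgroup.closure {S, U}).map (QuotientGroup.mk' Z) := by
    rw [MonoidHom.map_closure, Set.image_pair]
    rfl
  rw [h, closure_S_U]
  exact ⟨g, trivial, rfl⟩

theorem mk_wordProd (l : List ℕ) : ((wordProd U S l : H5) : G5) = wordProd (U : G5) (S : G5) l :=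
  map_wordProd (QuotientGroup.mk' Z) U S l

/-- Products of the letters U^i S have this property because λ > 1, and multiplication by S or -I
only permutes entries up to sign. It excludes diagonal units other than ±1 in upper triangular
elements. -/
theorem entries_dichotomy (g : H5) (i j : Fin 2) : ent g i j = 0 ∨ 1 ≤ |ent g i j| := by
  let P : H5 → Prop := fun g => ∀ i j, ent g i j = 0 ∨ 1 ≤ |ent g i j|
  have hneg : ∀ g, P g → P (negOne * g) := fun g hg i j => by
    rw [ent_negOne_mul, abs_neg, neg_eq_zero]
    exact hg i j
  have hSl : ∀ g, P g → P (S * g) := fun g hg i j => by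
    fin_cases i <;> fin_cases j
    · simpa [ent, mat_S_mul, -map_mul] using hg 1 0
    · simpa [ent, mat_S_mul, -map_mul] using hg 1 1
    · simpa [ent, mat_S_mul, -map_mul] using hg 0 0
    · simpa [ent, mat_S_mul, -map_mul] using hg 0 1
  have hSr : ∀ g, P g → P (g * S) := fun g hg i j => by
    fin_cases i <;> fin_cases j
    · simpa [ent, mat_mul_S, -map_mul] using hg 0 1
    · simpa [ent, mat_mul_S, -map_mul] using hg 0 0
    · simpa [ent, mat_mul_S, -map_mul] using hg 1 1
    · simpa [ent, mat_mul_S, -map_mul] using hg 1 0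
  have hpos : ∀ g, IsPositive g → P g := fun g hg i j => by
    fin_cases i <;> fin_cases j
    · exact Or.inr (hg.a.trans (le_abs_self _))
    · exact hg.b.imp_right fun h => h.trans (le_abs_self _)
    · exact hg.c.imp_right fun h => h.trans (le_abs_self _)
    · exact Or.inr (hg.d.trans (le_abs_self _))
  obtain ⟨l, hl, x, y, hx, hy, hg⟩ := exists_word mk_S_mul_self mk_U_pow_five (mk_mem_closure g)
  have hw := hpos _ (isPositive_word hl)
  rw [← mk_wordProd] at hg
  have key : ∃ h : H5, P h ∧ (g : G5) = h := by
    rcases hx with rfl | rfl <;> rcases hy with rfl | rfl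
    · exact ⟨_, hw, by rw [hg, one_mul, mul_one]⟩
    · exact ⟨_, hSr _ hw, by rw [hg, one_mul, QuotientGroup.mk_mul]⟩
    · exact ⟨_, hSl _ hw, by rw [hg, mul_one, QuotientGroup.mk_mul]⟩
    · exact ⟨_, hSr _ (hSl _ hw), by rw [hg, QuotientGroup.mk_mul, QuotientGroup.mk_mul]⟩
  obtain ⟨h, hP, hgh⟩ := key
  rcases mk_eq_mk_iff.mp hgh with rfl | rfl
  · exact hP i j
  · exact hneg h hP i j

/-- The diagonal entries have product 1 and absolute value at least 1, so they are equal to a common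
sign. -/
theorem commute_T_of_lower_eq_zero {g : H5} (h : mat g 1 0 = 0) : g * T = T * g := by
  have hc : ent g 1 0 = 0 := by rw [ent, h]; rfl
  have hdet := ent_det g
  rw [hc, mul_zero, sub_zero] at hdet
  have ha : 1 ≤ |ent g 0 0| := (entries_dichotomy g 0 0).resolve_left fun h0 => by simp [h0] at hdet
  have hd : 1 ≤ |ent g 1 1| := (entries_dichotomy g 1 1).resolve_left fun h0 => by simp [h0] at hdet
  have had : ent g 0 0 = ent g 1 1 := by
    have h1 : |ent g 0 0| * |ent g 1 1| = 1 := by rw [← abs_mul, hdet, abs_one]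
    have ha1 : |ent g 0 0| = 1 := by nlinarith
    have ha2 : ent g 0 0 * ent g 0 0 = 1 := by rw [← abs_mul_abs_self, ha1, mul_one]
    have hne : ent g 0 0 ≠ 0 := fun h0 => by simp [h0] at hdet
    exact mul_left_cancel₀ hne (ha2.trans hdet.symm)
  have had' : mat g 0 0 = mat g 1 1 := Subtype.ext had
  apply mat_injective
  rw [map_mul, map_mul, mat_T, Matrix.eta_fin_two (mat g), h, had', Matrix.mul_fin_two,
    Matrix.mul_fin_two]
  apply fin_two_congr <;> ring

/-! ### Parabolic elements -/

/-- The trace of an element of `H₅`, as a real number. -/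
def tr (g : H5) : ℝ := ent g 0 0 + ent g 1 1

theorem tr_mul_comm (g h : H5) : tr (g * h) = tr (h * g) := by
  simp only [tr, ent_mul]
  ring

theorem tr_conj (c g : H5) : tr (c * g * c⁻¹) = tr g := by
  rw [tr_mul_comm, inv_mul_cancel_left]

theorem exists_conj_of_isConj {g h : H5} (hgh : IsConj (g : G5) (h : G5)) :
    ∃ c : H5, (g : G5) = (c * h * c⁻¹ : H5) := by
  obtain ⟨c, hc⟩ := isConj_iff.mp hgh.symm
  obtain ⟨c, rfl⟩ := QuotientGroup.mk_surjective c
  exact ⟨c, hc.symm⟩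

theorem tr_sq_eq_of_isConj {g h : H5} (hgh : IsConj (g : G5) (h : G5)) : tr g ^ 2 = tr h ^ 2 := by
  obtain ⟨c, hc⟩ := exists_conj_of_isConj hgh
  rcases mk_eq_mk_iff.mp hc with rfl | rfl
  · rw [tr_conj]
  · rw [← tr_conj c h]
    simp only [tr, ent_negOne_mul]
    ring

theorem mat_letter_four_pow (n : ℕ) : mat ((U ^ 4 * S) ^ n) = !![1, 0; n * lamZ, 1] := by
  induction n with
  | zero => ext i j; fin_cases i <;> fin_cases j <;> simp
  | succ n ih =>
    rw [pow_succ, map_mul, ih, mat_letter_four, Matrix.mul_fin_two]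
    push_cast
    apply fin_two_congr <;> ring

theorem letter_four_eq : U ^ 4 * S = S * T⁻¹ * S⁻¹ := by
  apply mat_injective
  rw [mat_letter_four, map_mul, map_mul, mat_S, mat_T_inv, mat_S_inv, conj_inversion]
  apply fin_two_congr <;> ring

/-- The letters with i = 2, 3 have diagonal λ, λ and force trace at least 2λ > 2. The letters i = 1,
4 are upper and lower unipotent, and mixing them adds a positive off-diagonal contribution to the
trace. -/
theorem two_lt_tr_or_eq_pow {l : List ℕ} (hl : ∀ i ∈ l, 1 ≤ i ∧ i ≤ 4) :
    2 < tr (wordProd U S l) ∨ (∃ k : ℕ, wordProd U S l = T ^ k) ∨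
      ∃ k : ℕ, wordProd U S l = (U ^ 4 * S) ^ k := by
  induction l with
  | nil => exact Or.inr (Or.inl ⟨0, rfl⟩)
  | cons i l ih =>
    have hl' : ∀ j ∈ l, 1 ≤ j ∧ j ≤ 4 := fun j hj => hl j (by simp [hj])
    have hp := isPositive_word hl'
    have hb := hp.b_nonneg
    have hc := hp.c_nonneg
    have ha := hp.a
    have hd := hp.d
    have hlam := one_lt_lam
    obtain ⟨h1, h4⟩ := hl i (by simp)
    rw [wordProd_cons]
    have ih' := ih hl'
    generalize wordProd U S l = w at *
    interval_cases i
    · rw [pow_one, U_mul_S]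
      have e : tr (T * w) = ent w 0 0 + lam * ent w 1 0 + ent w 1 1 := by
        simp only [tr, ent_mul]
        simp [ent, mat_T, coe_lamZ]
      rcases ih' with h | ⟨k, rfl⟩ | ⟨k, rfl⟩
      · left
        rw [e]
        rw [tr] at h
        nlinarith
      · exact Or.inr (Or.inl ⟨k + 1, (pow_succ' T k).symm⟩)
      · rcases Nat.eq_zero_or_pos k with rfl | hk
        · exact Or.inr (Or.inl ⟨1, by simp⟩)
        · left
          have h0 : ent ((U ^ 4 * S) ^ k) 1 0 = k * lam := by
            rw [ent, mat_letter_four_pow]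
            simp [coe_lamZ]
          have hk' : (1 : ℝ) ≤ k := by exact_mod_cast hk
          rw [e, h0]
          nlinarith [mul_pos (zero_lt_one.trans_le hk') (zero_lt_one.trans hlam)]
    · left
      have e : tr (U ^ 2 * S * w) =
          lam * ent w 0 0 + lam * ent w 1 0 + (ent w 0 1 + lam * ent w 1 1) := by
        simp only [tr, ent_mul _ w]
        simp [ent, mat_letter_two, coe_lamZ, -map_mul]
      rw [e]
      nlinarith
    · left
      have e : tr (U ^ 3 * S * w) =
          lam * ent w 0 0 + ent w 1 0 + (lam * ent w 0 1 + lam * ent w 1 1) := by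
        simp only [tr, ent_mul _ w]
        simp [ent, mat_letter_three, coe_lamZ, -map_mul]
      rw [e]
      nlinarith
    · have e : tr (U ^ 4 * S * w) = ent w 0 0 + (lam * ent w 0 1 + ent w 1 1) := by
        simp only [tr, ent_mul _ w]
        simp [ent, mat_letter_four, coe_lamZ, -map_mul]
      rcases ih' with h | ⟨k, rfl⟩ | ⟨k, rfl⟩
      · left
        rw [e]
        rw [tr] at h
        nlinarith
      · rcases Nat.eq_zero_or_pos k with rfl | hk
        · exact Or.inr (Or.inr ⟨1, by simp⟩)
        · left
          have h0 : ent (T ^ k) 0 1 = k * lam := by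
            rw [ent, mat_T_pow]
            simp [coe_lamZ]
          have hk' : (1 : ℝ) ≤ k := by exact_mod_cast hk
          rw [e, h0]
          nlinarith [mul_pos (zero_lt_one.trans_le hk') (zero_lt_one.trans hlam)]
      · exact Or.inr (Or.inr ⟨k + 1, (pow_succ' _ k).symm⟩)

theorem tr_U_pow_sq {j : ℕ} (hj : j < 5) (h : tr (U ^ j) ^ 2 = 4) : j = 0 := by
  have hl := lam_sq
  interval_cases j
  · rfl
  · have e : tr (U ^ 1) = lam := by simp [tr, ent, mat_U, coe_lamZ]
    rw [e] at h
    have : lam = 3 := by linarith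
    norm_num [this] at h
  · have e : tr (U ^ 2) = lam - 1 := by simp [tr, ent, mat_U_sq, coe_lamZ, -map_pow]; ring
    rw [e] at h
    have : lam = -2 := by linarith
    norm_num [this] at hl
  · have e : tr (U ^ 3) = 1 - lam := by simp [tr, ent, mat_U_cube, coe_lamZ, -map_pow]; ring
    rw [e] at h
    have : lam = -2 := by linarith
    norm_num [this] at hl
  · have e : tr (U ^ 4) = -lam := by simp [tr, ent, mat_U_four, coe_lamZ, -map_pow]
    rw [e] at h
    have : lam = 3 := by linarith
    norm_num [this] at hl

/-- An element of `H₅` whose trace is `±2` is, up to sign, conjugate to a power of `T`. -/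
theorem exists_conj_T_zpow {g : H5} (hg : tr g ^ 2 = 4) :
    ∃ (c : H5) (k : ℤ), (g : G5) = (c * T ^ k * c⁻¹ : H5) := by
  suffices h : ∃ k : ℤ, IsConj (g : G5) ((T ^ k : H5) : G5) by
    obtain ⟨k, hk⟩ := h
    obtain ⟨c, hc⟩ := exists_conj_of_isConj hk
    exact ⟨c, k, hc⟩
  rcases isConj_word mk_S_mul_self mk_U_pow_five (mk_mem_closure g) with
    ⟨l, hl, hc⟩ | hc | ⟨j, hc⟩
  · rw [← mk_wordProd] at hc
    have htr := tr_sq_eq_of_isConj hc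
    rcases two_lt_tr_or_eq_pow hl with h | ⟨k, hk⟩ | ⟨k, hk⟩
    · nlinarith
    · exact ⟨k, by rwa [hk, ← zpow_natCast] at hc⟩
    -- The lower unipotent letter is ST⁻¹S⁻¹, hence the negative exponent.
    · refine ⟨-k, hc.trans ?_⟩
      rw [hk, letter_four_eq, conj_pow, inv_pow, zpow_neg, zpow_natCast]
      exact (isConj_iff.mpr ⟨(S : G5), rfl⟩ : IsConj ((T ^ k : H5)⁻¹ : G5) _).symm
  · have htr := tr_sq_eq_of_isConj hc
    have e : tr S = 0 := by simp [tr, ent, mat_S]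
    rw [e, hg] at htr
    norm_num at htr
  · rw [pow_eq_pow_mod _ mk_U_pow_five, ← QuotientGroup.mk_pow] at hc
    have htr := tr_sq_eq_of_isConj hc
    have hj := tr_U_pow_sq (Nat.mod_lt j (by norm_num)) (htr.symm.trans hg)
    exact ⟨0, by rwa [hj, pow_zero, ← zpow_zero T] at hc⟩

/-! ### Cusps and their widths -/

open OnePoint in
theorem smul_infty_iff {g : H5} : toGL g • (∞ : OnePoint ℝ) = ∞ ↔ mat g 1 0 = 0 := by
  rw [OnePoint.smul_infty_eq_self_iff, toGL_apply, ent]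
  exact ZeroMemClass.coe_eq_zero

theorem smul_infty_eq_of_conj {g A : H5} (h : mat (g⁻¹ * A * g) 1 0 = 0) :
    toGL A • (toGL g • (OnePoint.infty : OnePoint ℝ)) = toGL g • OnePoint.infty := by
  have h' := smul_infty_iff.mpr h
  rwa [map_mul, map_mul, mul_smul, mul_smul, map_inv, inv_smul_eq_iff] at h'

theorem lower_eq_zero_of_smul {g A : H5}
    (h : toGL A • (toGL g • (OnePoint.infty : OnePoint ℝ)) = toGL g • OnePoint.infty) :
    mat (g⁻¹ * A * g) 1 0 = 0 := by
  rw [← smul_infty_iff, map_mul, map_mul, mul_smul, mul_smul, map_inv, inv_smul_eq_iff]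
  exact h

theorem mat_T_zpow_lower (k : ℤ) : mat (T ^ k) 1 0 = 0 := by
  rcases Int.eq_nat_or_neg k with ⟨n, rfl | rfl⟩
  · rw [zpow_natCast, mat_T_pow]
    simp
  · rw [zpow_neg, zpow_natCast, mat_inv, mat_T_pow, Matrix.adjugate_fin_two_of]
    simp

theorem conj_T_pow_lower (f : H5) (m : ℕ) :
    mat (f * T ^ m * f⁻¹) 1 0 = -(mat f 1 0 ^ 2 * (m * lamZ)) := by
  rw [map_mul, map_mul, mat_T_pow, mat_inv, Matrix.eta_fin_two (mat f),
    Matrix.adjugate_fin_two_of, Matrix.mul_fin_two, Matrix.mul_fin_two]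
  simp only [Matrix.of_apply, Matrix.cons_val_one, Matrix.cons_val_zero, Matrix.cons_val',
    Matrix.cons_val_fin_one]
  ring

theorem lamZ_ne_zero : lamZ ≠ 0 := fun h => by
  have := one_lt_lam
  rw [← coe_lamZ, h] at this
  norm_num at this

/-- A conjugate of `±T ^ m` which fixes the cusp `g ∞` is `±g T ^ m g⁻¹`. -/
theorem eq_conj_of_smul_eq {m : ℕ} (hm : m ≠ 0) {g A : H5} (hA : IsConj ((T : G5) ^ m) (A : G5))
    (hx : toGL A • (toGL g • (OnePoint.infty : OnePoint ℝ)) = toGL g • OnePoint.infty) :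
    (A : G5) = ((g : G5) * T * (g : G5)⁻¹) ^ m := by
  rw [← QuotientGroup.mk_pow] at hA
  obtain ⟨h, hh⟩ := exists_conj_of_isConj hA.symm
  -- This conjugate of T^m fixes ∞. Its lower-left entry is -c²mλ, where c is that of g⁻¹h, so c = 0
  -- and g⁻¹h commutes with T.
  have h0 : mat (g⁻¹ * h * T ^ m * (g⁻¹ * h)⁻¹) 1 0 = 0 := by
    have h1 := lower_eq_zero_of_smul hx
    have e : g⁻¹ * h * T ^ m * (g⁻¹ * h)⁻¹ = g⁻¹ * (h * T ^ m * h⁻¹) * g := by group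
    rw [e]
    rcases mk_eq_mk_iff.mp hh with rfl | rfl
    · exact h1
    · have e' : g⁻¹ * (negOne * (h * T ^ m * h⁻¹)) * g =
          negOne * (g⁻¹ * (h * T ^ m * h⁻¹) * g) := by
        rw [← mul_assoc, ← negOne_mul_comm]
        group
      rw [e', map_mul, mat_negOne, neg_one_mul, Matrix.neg_apply, neg_eq_zero] at h1
      exact h1
  rw [conj_T_pow_lower, neg_eq_zero] at h0
  have hc : mat (g⁻¹ * h) 1 0 = 0 := by
    have hml : (m : ZLam) * lamZ ≠ 0 := mul_ne_zero (by exact_mod_cast hm) lamZ_ne_zero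
    exact pow_eq_zero_iff (two_ne_zero) |>.mp ((mul_eq_zero.mp h0).resolve_right hml)
  have hcomm : Commute (g⁻¹ * h) (T ^ m) :=
    Commute.pow_right (commute_T_of_lower_eq_zero hc) m
  have e : h * T ^ m * h⁻¹ = (g * T * g⁻¹) ^ m := by
    have e1 : h * T ^ m * h⁻¹ = g * (g⁻¹ * h * T ^ m) * (g⁻¹ * h)⁻¹ * g⁻¹ := by group
    rw [e1, hcomm.eq, conj_pow]
    group
  rw [hh, e]
  rfl

theorem conj_T_pow_smul (g : H5) (m : ℕ) :
    toGL ((g * T * g⁻¹) ^ m) • (toGL g • (OnePoint.infty : OnePoint ℝ)) =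
      toGL g • OnePoint.infty := by
  refine smul_infty_eq_of_conj ?_
  have e : g⁻¹ * (g * T * g⁻¹) ^ m * g = T ^ (m : ℤ) := by
    rw [conj_pow, zpow_natCast]
    group
  rw [e, mat_T_zpow_lower]

/-- The only conjugate of ±T^m fixing g∞ is ±gT^m g⁻¹, so the width is the least positive exponent
of a single element lying in K. -/
theorem cuspWidth_smul_infty (K : Subgroup G5) (g : H5) :
    cuspWidth K (toGL g • OnePoint.infty) =
      sInf {m : ℕ | 0 < m ∧ ((g : G5) * T * (g : G5)⁻¹) ^ m ∈ K} := by
  rw [cuspWidth]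
  congr 1
  ext m
  refine and_congr_right fun hm => ⟨?_, fun h => ?_⟩
  · rintro ⟨A, hA, hconj, hx⟩
    rwa [← eq_conj_of_smul_eq hm.ne' hconj hx]
  · refine ⟨(g * T * g⁻¹) ^ m, h, ?_, conj_T_pow_smul g m⟩
    refine isConj_iff.mpr ⟨(g : G5), ?_⟩
    rw [← conj_pow]
    rfl

theorem sInf_pow_mem_dvd {G : Type*} [Group G] {K : Subgroup G} {t : G} {n : ℕ}
    (hn : t ^ n ∈ K) : sInf {m : ℕ | 0 < m ∧ t ^ m ∈ K} ∣ n := by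
  set w := sInf {m : ℕ | 0 < m ∧ t ^ m ∈ K} with hw
  rcases Nat.eq_zero_or_pos n with rfl | hpos
  · exact dvd_zero _
  obtain ⟨hw0, hwK⟩ : 0 < w ∧ t ^ w ∈ K :=
    Nat.sInf_mem (s := {m : ℕ | 0 < m ∧ t ^ m ∈ K}) ⟨n, hpos, hn⟩
  by_contra hdvd
  have hmod : 0 < n % w := Nat.pos_of_ne_zero fun h => hdvd (Nat.dvd_of_mod_eq_zero h)
  have hmem : t ^ (n % w) ∈ K := by
    rw [← Nat.div_add_mod n w, pow_add, pow_mul] at hn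
    exact (Subgroup.mul_mem_cancel_left _ (pow_mem hwK _)).mp hn
  exact absurd (Nat.sInf_le (show n % w ∈ {m : ℕ | 0 < m ∧ t ^ m ∈ K} from ⟨hmod, hmem⟩))
    (not_le.mpr (Nat.mod_lt _ hw0))

theorem isCuspOf_smul_infty {K : Subgroup G5} {g : H5} {m : ℕ} (hm : m ≠ 0)
    (h : ((g : G5) * T * (g : G5)⁻¹) ^ m ∈ K) : IsCuspOf K (toGL g • OnePoint.infty) := by
  refine ⟨toGL ((g * T * g⁻¹) ^ m), ⟨_, h, rfl⟩, ?_, conj_T_pow_smul g m⟩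
  rw [conj_pow, map_mul, map_mul, map_inv, Matrix.GeneralLinearGroup.isParabolic_conj_iff,
    Matrix.GeneralLinearGroup.isParabolic_iff_of_upperTriangular]
  · simp only [toGL_apply, ent, mat_T_pow]
    simpa using ⟨hm, lamZ_ne_zero⟩
  · simp only [toGL_apply, ent, mat_T_pow]
    simp

theorem exists_eq_smul_infty {K : Subgroup G5} {x : OnePoint ℝ} (hx : IsCuspOf K x) :
    ∃ g : H5, x = toGL g • OnePoint.infty := by
  obtain ⟨_, ⟨A, -, rfl⟩, hpar, hfix⟩ := hx
  have htr : tr A ^ 2 = 4 := by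
    have h := hpar.2
    rw [Matrix.discr_fin_two, Matrix.trace_fin_two, Matrix.det_fin_two] at h
    have hdet := ent_det A
    simp only [← toGL_apply] at hdet
    simp only [tr, ← toGL_apply]
    linear_combination h + 4 * hdet
  obtain ⟨c, k, hA⟩ := exists_conj_T_zpow htr
  refine ⟨c, ?_⟩
  have hc : toGL A • (toGL c • (OnePoint.infty : OnePoint ℝ)) = toGL c • OnePoint.infty := by
    refine smul_infty_eq_of_conj ?_
    rcases mk_eq_mk_iff.mp hA with rfl | rfl
    · have e : c⁻¹ * (c * T ^ k * c⁻¹) * c = T ^ k := by group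
      rw [e, mat_T_zpow_lower]
    · have e : c⁻¹ * (negOne * (c * T ^ k * c⁻¹)) * c = negOne * T ^ k := by
        rw [← mul_assoc, ← negOne_mul_comm]
        group
      rw [e, map_mul, mat_negOne, neg_one_mul, Matrix.neg_apply, mat_T_zpow_lower, neg_zero]
  -- A parabolic element has a unique fixed point, so x and c∞ coincide.
  rw [hpar.smul_eq_self_iff] at hfix hc
  rw [hfix, hc]

/-! ### The geometric level -/

theorem principalG_le_iff {K : Subgroup G5} {ϖ : ZLam} :
    principalG ϖ ≤ K ↔ principalH ϖ ≤ K.comap (QuotientGroup.mk' Z) :=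
  Subgroup.map_le_iff_le_comap

theorem conj_T_pow_mem {K : Subgroup G5} {n : ℕ} (h : principalG (n : ZLam) ≤ K) (g : H5) :
    ((g : G5) * T * (g : G5)⁻¹) ^ n ∈ K := by
  have h1 : g * T ^ n * g⁻¹ ∈ principalH (n : ZLam) :=
    (principalH_normal _).conj_mem _ (T_pow_mem_principalH n) g
  rw [← conj_pow] at h1
  exact principalG_le_iff.mp h h1

theorem cuspWidth_dvd {K : Subgroup G5} {n : ℕ} (h : principalG (n : ZLam) ≤ K) {x : OnePoint ℝ}
    (hx : IsCuspOf K x) : cuspWidth K x ∣ n := by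
  obtain ⟨g, rfl⟩ := exists_eq_smul_infty hx
  rw [cuspWidth_smul_infty]
  exact sInf_pow_mem_dvd (conj_T_pow_mem h g)

theorem geometricLevel_le {K : Subgroup G5} {n : ℕ} (hn : 0 < n)
    (h : principalG (n : ZLam) ≤ K) : geometricLevel K ≤ n :=
  Nat.sInf_le ⟨hn, fun _ hx => cuspWidth_dvd h hx⟩

theorem exists_pos_principalG_le {K : Subgroup G5} (hK : IsCongruence K) :
    ∃ n : ℕ, 0 < n ∧ principalG (n : ZLam) ≤ K := by
  obtain ⟨ϖ, hϖ, hle⟩ := hK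
  obtain ⟨n, hn, hdvd⟩ := exists_pos_nat_dvd hϖ
  exact ⟨n, hn, (Subgroup.map_mono (principalH_le_of_dvd hdvd)).trans hle⟩

/-- Any positive n with G(n) ≤ K is a common multiple of the widths, so the infimum is attained and
is not the default value 0. -/
theorem geometricLevel_spec {K : Subgroup G5} (hK : IsCongruence K) :
    0 < geometricLevel K ∧ ∀ x : OnePoint ℝ, IsCuspOf K x → cuspWidth K x ∣ geometricLevel K := by
  obtain ⟨n, hn, hle⟩ := exists_pos_principalG_le hK
  exact Nat.sInf_mem (s := {N : ℕ | 0 < N ∧ ∀ x : OnePoint ℝ, IsCuspOf K x → cuspWidth K x ∣ N})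
    ⟨n, hn, fun _ hx => cuspWidth_dvd hle hx⟩

theorem normalT_geometricLevel_le {K : Subgroup G5} (hK : IsCongruence K) :
    normalT (geometricLevel K) ≤ K.comap (QuotientGroup.mk' Z) := by
  obtain ⟨n, hn, hle⟩ := exists_pos_principalG_le hK
  refine (Subgroup.closure_le _).mpr fun y hy => ?_
  obtain ⟨_, rfl, hconj⟩ := Group.mem_conjugatesOfSet_iff.mp hy
  obtain ⟨g, rfl⟩ := isConj_iff.mp hconj
  have hmem := conj_T_pow_mem hle g
  have hw : ((g : G5) * T * (g : G5)⁻¹) ^ cuspWidth K (toGL g • OnePoint.infty) ∈ K := by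
    rw [cuspWidth_smul_infty]
    exact (Nat.sInf_mem (s := {m : ℕ | 0 < m ∧ ((g : G5) * T * (g : G5)⁻¹) ^ m ∈ K})
      ⟨n, hn, hmem⟩).2
  obtain ⟨d, hd⟩ := (geometricLevel_spec hK).2 _ (isCuspOf_smul_infty hn.ne' hmem)
  rw [hd, ← conj_pow, pow_mul]
  exact K.pow_mem hw d

theorem principalG_le_of_forall {K : Subgroup G5} (hK : IsCongruence K) {m : ℕ}
    (h : ∀ n : ℕ, n ≠ 0 → principalH (m : ZLam) ≤
      normalT (geometricLevel K) ⊔ principalH (n : ZLam)) : principalG (m : ZLam) ≤ K := by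
  obtain ⟨n, hn, hle⟩ := exists_pos_principalG_le hK
  exact principalG_le_iff.mpr ((h n hn.ne').trans
    (sup_le (normalT_geometricLevel_le hK) (principalG_le_iff.mp hle)))

/-! ### The algebraic level -/

theorem dvd_of_principalG_le {n : ℕ} {ϖ : ZLam} (h : principalG (n : ZLam) ≤ principalG ϖ) :
    ϖ ∣ (n : ZLam) := by
  obtain ⟨g, hg, hgT⟩ := h ⟨T ^ n, T_pow_mem_principalH n, rfl⟩
  obtain ⟨B, hB⟩ := mem_principalH.mp hg
  have h01 : mat g 0 1 = ϖ * B 0 1 := by rw [hB]; simp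
  have hT : mat (T ^ n) 0 1 = n * lamZ := by rw [mat_T_pow]; rfl
  -- λ is a unit with inverse λ - 1, so dividing nλ is the same as dividing n.
  have hunit : ((n : ZLam) * lamZ) * (lamZ - 1) = n := by linear_combination (n : ZLam) * lamZ_sq
  rw [← hunit, ← hT]
  refine Dvd.dvd.mul_right ?_ _
  rcases mk_eq_mk_iff.mp (show (g : G5) = ((T ^ n : H5) : G5) from hgT) with rfl | rfl
  · exact ⟨_, h01⟩
  · rw [map_mul, mat_negOne, neg_one_mul, Matrix.neg_apply] at h01
    exact ⟨-B 0 1, by linear_combination -h01⟩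

theorem integerBelow_spec {K : Subgroup G5} {ϖ : ZLam} (hϖ : IsAlgebraicLevel K ϖ) {m : ℕ}
    (hm : 0 < m) (h : principalG (m : ZLam) ≤ K) :
    integerBelow ϖ ∣ m ∧ geometricLevel K ≤ integerBelow ϖ := by
  obtain ⟨-, hle, hmax⟩ := hϖ
  have hdvd := dvd_of_principalG_le (hmax _ h)
  have hspec : 0 < integerBelow ϖ ∧ (integerBelow ϖ : ZLam) ∈ Ideal.span {ϖ} :=
    Nat.sInf_mem (s := {m : ℕ | 0 < m ∧ (m : ZLam) ∈ Ideal.span {ϖ}})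
      ⟨m, hm, Ideal.mem_span_singleton.mpr hdvd⟩
  obtain ⟨h0, hmem⟩ := hspec
  refine ⟨?_, geometricLevel_le h0 ((Subgroup.map_mono
    (principalH_le_of_dvd (Ideal.mem_span_singleton.mp hmem))).trans hle)⟩
  by_contra hnd
  have hmod : 0 < m % integerBelow ϖ := Nat.pos_of_ne_zero fun h => hnd (Nat.dvd_of_mod_eq_zero h)
  have hmod' : ((m % integerBelow ϖ : ℕ) : ZLam) ∈ Ideal.span {ϖ} := by
    have e : (m : ZLam) = (integerBelow ϖ : ZLam) * (m / integerBelow ϖ : ℕ) +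
        (m % integerBelow ϖ : ℕ) := by exact_mod_cast (Nat.div_add_mod m (integerBelow ϖ)).symm
    have hm' := Ideal.mem_span_singleton.mpr hdvd
    rw [e] at hm'
    exact (Ideal.add_mem_iff_right _ (Ideal.mul_mem_right _ _ hmem)).mp hm'
  exact absurd (Nat.sInf_le (show m % integerBelow ϖ ∈
    {m : ℕ | 0 < m ∧ (m : ZLam) ∈ Ideal.span {ϖ}} from ⟨hmod, hmod'⟩))
    (not_le.mpr (Nat.mod_lt _ h0))

theorem integerBelow_eq {K : Subgroup G5} (hK : IsCongruence K)
    (h : principalG (geometricLevel K : ZLam) ≤ K) {ϖ : ZLam} (hϖ : IsAlgebraicLevel K ϖ) :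
    integerBelow ϖ = geometricLevel K := by
  have hpos := (geometricLevel_spec hK).1
  obtain ⟨h1, h2⟩ := integerBelow_spec hϖ hpos h
  exact le_antisymm (Nat.le_of_dvd hpos h1) h2

end Hecke
end
/-- **Wohlfahrt's theorem for `G₅`.** Let `K` be a congruence subgroup of `G₅` of geometric
level `r`. For each of the three classes of `r` modulo `4`, the first assertion does not mention
the algebraic level; the second one holds for every generator `ϖ` of the algebraic level of `K`,
whose rational integer below is `integerBelow ϖ`. -/
theorem theorem4p1 (K : Subgroup Hecke.G5) (hK : Hecke.IsCongruence K)
    (r : ℕ) (hr : r = Hecke.geometricLevel K) :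
    (Odd r → Hecke.principalG (r : Hecke.ZLam) ≤ K ∧
      ∀ ϖ : Hecke.ZLam, Hecke.IsAlgebraicLevel K ϖ → Hecke.integerBelow ϖ = r) ∧
    (r ≡ 2 [MOD 4] → Hecke.principalG (r : Hecke.ZLam) ≤ K ∧
      ∀ ϖ : Hecke.ZLam, Hecke.IsAlgebraicLevel K ϖ → Hecke.integerBelow ϖ = r) ∧
    (4 ∣ r → Hecke.principalG ((2 * r : ℕ) : Hecke.ZLam) ≤ K ∧
      ∀ ϖ : Hecke.ZLam, Hecke.IsAlgebraicLevel K ϖ →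
        Hecke.integerBelow ϖ = r ∨ Hecke.integerBelow ϖ = 2 * r) := by

  subst hr
  have hpos := (Hecke.geometricLevel_spec hK).1
  refine ⟨fun hodd => ?_, fun hmod => ?_, ?_⟩
  · have h := Hecke.principalG_le_of_forall hK fun n hn => Hecke.principalH_le_of_odd_level hodd hn
    exact ⟨h, fun ϖ hϖ => Hecke.integerBelow_eq hK h hϖ⟩
  · have h : Hecke.principalG (Hecke.geometricLevel K : Hecke.ZLam) ≤ K := by
      refine Hecke.principalG_le_of_forall hK fun n hn => ?_
      have hr2 : Hecke.geometricLevel K % 4 = 2 := hmod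
      obtain ⟨s, hs⟩ : 2 ∣ Hecke.geometricLevel K := by omega
      rw [hs]
      exact Hecke.principalH_le_of_two_mul_odd_level (Nat.odd_iff.mpr (by omega)) hn
    exact ⟨h, fun ϖ hϖ => Hecke.integerBelow_eq hK h hϖ⟩
  · rintro ⟨q, hq⟩
    have h : Hecke.principalG ((2 * Hecke.geometricLevel K : ℕ) : Hecke.ZLam) ≤ K := by
      refine Hecke.principalG_le_of_forall hK fun n hn => ?_
      rw [hq]
      exact Hecke.principalH_le_of_four_mul_level (by omega) hn
    refine ⟨h, fun ϖ hϖ => ?_⟩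
    obtain ⟨⟨c, hc⟩, hle⟩ := Hecke.integerBelow_spec hϖ (by omega) h
    -- The integer below is at least r > 0 and its product with c is 2r, which leaves only c = 1 or
    -- c = 2.
    have hc2 : c ≤ 2 := by
      by_contra hc2
      have : Hecke.integerBelow ϖ * 3 ≤ Hecke.integerBelow ϖ * c := Nat.mul_le_mul_left _ (by omega)
      omega
    interval_cases c <;> omega
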